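/- Work with differential graded symmetric operads over $\mathbb{Z}$, i.e. operads in the symmetric monoidal category of complexes of $\mathbb{Z}$-modules with Koszul signs, so that $d(x\circ_i y)=dx\circ_i y+(-1)^{\dim x}x\circ_i dy$. Chain complexes (differential of dimension $-1$) are regarded as cochain complexes by placing an element of dimension $k$ in degree $-k$. For a binary operation $x$ let $x^{\sigma}$ be $x$ with its two inputs exchanged; $x\circ_1y=x(y(1,2),3)$ and $x\circ_2y=x(1,y(2,3))$; $\tau$ relabels inputs by the cycle $3\to2\to1\to3$, and $(23)$ exchanges the labels $2$ and $3$. Each operad below is the quotient of the free dg operad on the indicated complex of binary generators by the ideal generated by the indicated relations. *Zero differential, generators of dimension $0$.* - $\mathrm{Zin}$: $\prec$ with $(x\prec y)\prec z=x\prec(y\prec z)+x\prec(z\prec y)$. - $\mathrm{Dend}$: $\prec,\succ$ with $x\succ(y\prec z)=(x\succ y)\prec z$, $x\succ(y\succ z)=(x\succ y)\succ z+(x\prec y)\succ z$, $(x\prec y)\prec z=x\prec(y\prec z)+x\prec(y\succ z)$. - $\mathrm{PreLie}$: $\curvearrowleft$ with $(x\curvearrowleft y)\curvearrowleft z-x\curvearrowleft(y\curvearrowleft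 z)=(x\curvearrowleft z)\curvearrowleft y-x\curvearrowleft(z\curvearrowleft y)$. - $\mathrm{Com}$, $\mathrm{As}$, $\mathrm{Lie}$: the usual operads, with generators $m_{\mathrm{Com}}$, $m$, $[\,,]_{\mathrm{Lie}}$. - $\mathrm{Perm}$: a product with $(xy)z=x(yz)=x(zy)$. - $\mathrm{Dias}$: $\dashv,\vdash$ with $(x\vdash y)\dashv z=x\vdash(y\dashv z)$, $x\dashv(y\dashv z)=x\dashv(y\vdash z)=(x\dashv y)\dashv z$, $(x\vdash y)\vdash z=(x\dashv y)\vdash z=x\vdash(y\vdash z)$. - $\mathrm{Leib}$: $\langle\,,\rangle$ with $\langle x,\langle y,z\rangle\rangle=\langle\langle x,y\rangle,z\rangle-\langle\langle x,z\rangle,y\rangle$. *Cochain operads.* - $\Pi$ (permutohedra): $t=1\otimes2$ of dimension $0$ and $w=1\wedge2$ of dimension $1$ with $w^\sigma=-w$; $dt=w$, $dw=0$; $t\circ_1t=t\circ_2t+t\circ_2t^\sigma$, $w\circ_2t=t\circ_1w=\tau(w\circ_1t^\sigma)$, $w^\sigma\circ_1w=w\circ_2w$. - $K$ (associahedra): $l=(1<2)$,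 $g=(1>2)$ of dimension $0$ and $b=(1|2)$ of dimension $1$; $dl=-dg=b$, $db=0$; $g\circ_2l=l\circ_1g$, $g\circ_2g=g\circ_1g+g\circ_1l$, $l\circ_1l=l\circ_2l+l\circ_2g$, $g\circ_2b=b\circ_1g$, $l\circ_1b=b\circ_2l$, $b\circ_1l=b\circ_2g$, $b\circ_1b=-b\circ_2b$. - $\Lambda$: $a=(1\curvearrowleft2)$ of dimension $0$ and $c=[1,2]$ of dimension $1$ with $c^\sigma=c$; $da=c$, $dc=0$; $a\circ_1a-a\circ_2a=(23)(a\circ_1a-a\circ_2a)$, $a\circ_1c=(23)(c\circ_1a)+c\circ_2a$, $c\circ_1c+\tau(c\circ_1c)+\tau^2(c\circ_1c)=0$. *Chain operads.* - $\mathrm{Pasc}$ (simplices): $e_1$ of dimension $0$, $e_2=e_1^\sigma$, and $w=e_1\wedge e_2$ of dimension $1$ with $w^\sigma=-w$; $dw=e_1-e_2$, $de_1=0$; $e_1\circ_1e_1=\tau^2(e_2\circ_1e_1)$, $e_2\circ_1e_1=e_2\circ_1e_2$, $e_1\circ_1e_2=\tau(e_2\circ_1e_2)$, $e_2\circ_1w=0$,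 $\tau(w\circ_1e_2)=e_1\circ_1w=-\tau^2(w\circ_1e_1)$, $w\circ_1w=\tau(w\circ_1w)$. - $\mathrm{Trias}$: $\dashv,\vdash$ of dimension $0$ and $\times$ of dimension $1$; $d(\times)={\dashv}-{\vdash}$, $d(\dashv)=d(\vdash)=0$; the relations of $\mathrm{Dias}$ for $\dashv,\vdash$, together with $\times\circ_1\vdash=\vdash\circ_2\times$, $\times\circ_2\dashv=\dashv\circ_1\times$, $\times\circ_1\dashv=\times\circ_2\vdash$, $\vdash\circ_1\times=0$, $\dashv\circ_2\times=0$, $\times\circ_1\times=-\times\circ_2\times$. - $\amalg$: $u=\langle1,2\rangle$ of dimension $0$ and $c=[1,2]$ of dimension $1$ with $c^\sigma=c$; $dc=u+u^\sigma$, $du=0$; $u\circ_1u-\tau(u\circ_1u^\sigma)+\tau^2(u^\sigma\circ_1u^\sigma)=0$, $\tau^2(c\circ_1u)+\tau(c\circ_1u^\sigma)=u\circ_1c$, $u^\sigma\circ_1c=0$, $c\circ_1c+\tau(c\circ_1c)+\tau^2(c\circ_1c)=0$. **Proposition.** There are unique morphisms of dg operads given on generators as follows. Horizontal: $\mathrm{Dend}\to\mathrm{Zin}$: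 $\prec\,\mapsto\,\prec$, $\succ\,\mapsto\,\prec^\sigma$. $\mathrm{PreLie}\to\mathrm{Dend}$: $\curvearrowleft\,\mapsto\,\prec-\succ^\sigma$. $K\to\Pi$: $l\mapsto t$, $g\mapsto t^\sigma$, $b\mapsto w$. $\Lambda\to K$: $a\mapsto l-g^\sigma$, $c\mapsto b+b^\sigma$. $\mathrm{As}\to\mathrm{Com}$: $m\mapsto m_{\mathrm{Com}}$. $\mathrm{Lie}\to\mathrm{As}$: $[\,,]_{\mathrm{Lie}}\mapsto m-m^\sigma$. $\mathrm{Trias}\to\mathrm{Pasc}$: $\dashv\,\mapsto e_1$, $\vdash\,\mapsto e_2$, $\times\mapsto w$. $\amalg\to\mathrm{Trias}$: $u\mapsto{\dashv}-{\vdash^\sigma}$, $c\mapsto\times+\times^\sigma$. $\mathrm{Dias}\to\mathrm{Perm}$: $\dashv\,\mapsto xy$, $\vdash\,\mapsto yx$. $\mathrm{Leib}\to\mathrm{Dias}$: $\langle\,,\rangle\mapsto{\dashv}-{\vdash^\sigma}$. Vertical: $\Pi\to\mathrm{Zin}$: $t\mapsto\prec$, $w\mapsto0$. $K\to\mathrm{Dend}$: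 $l\mapsto\prec$, $g\mapsto\succ$, $b\mapsto0$. $\Lambda\to\mathrm{PreLie}$: $a\mapsto\curvearrowleft$, $c\mapsto0$. $\mathrm{Com}\to\Pi$: $m_{\mathrm{Com}}\mapsto t+t^\sigma$. $\mathrm{As}\to K$: $m\mapsto l+g$. $\mathrm{Lie}\to\Lambda$: $[\,,]_{\mathrm{Lie}}\mapsto a-a^\sigma$. $\mathrm{Pasc}\to\mathrm{Com}$: $e_1\mapsto m_{\mathrm{Com}}$, $w\mapsto0$. $\mathrm{Trias}\to\mathrm{As}$: $\dashv,\vdash\,\mapsto m$, $\times\mapsto0$. $\amalg\to\mathrm{Lie}$: $u\mapsto[\,,]_{\mathrm{Lie}}$, $c\mapsto0$. $\mathrm{Perm}\to\mathrm{Pasc}$: $xy\mapsto e_1$. $\mathrm{Dias}\to\mathrm{Trias}$: $\dashv\,\mapsto\,\dashv$, $\vdash\,\mapsto\,\vdash$. $\mathrm{Leib}\to\amalg$: $\langle\,,\rangle\mapsto u$. With these morphisms, all eight squares of the following diagram commute: $$\begin{array}{ccccc} \mathrm{Zin}&\leftarrow&\mathrm{Dend}&\leftarrow&\mathrm{PreLie}\\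 \uparrow&&\uparrow&&\uparrow\\ \Pi&\leftarrow&K&\leftarrow&\Lambda\\ \uparrow&&\uparrow&&\uparrow\\ \mathrm{Com}&\leftarrow&\mathrm{As}&\leftarrow&\mathrm{Lie}\\ \uparrow&&\uparrow&&\uparrow\\ \mathrm{Pasc}&\leftarrow&\mathrm{Trias}&\leftarrow&\amalg\\ \uparrow&&\uparrow&&\uparrow\\ \mathrm{Perm}&\leftarrow&\mathrm{Dias}&\leftarrow&\mathrm{Leib} \end{array}$$ -/

import Mathlib

/-! ## Differential graded symmetric operads over `ℤ`

Operads are given by partial compositions indexed by finite sets.  All complexes are graded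
cohomologically (the differential raises the degree by one).  A chain complex is regarded as a
cochain complex in the usual way: an element of dimension `k` has degree `-k`. -/

namespace DGOp

/-- Relabelling of `(I \ {i}) ⊔ J` induced by bijections `σ : I ≃ I'` and `τ : J ≃ J'`,
where `σ i = i'`. -/
def relabelEquiv {I I' J J' : Type} (σ : I ≃ I') (τ : J ≃ J') {i : I} {i' : I'} (hi : σ i = i') :
    ({x : I // x ≠ i} ⊕ J) ≃ ({x : I' // x ≠ i'} ⊕ J') :=
  Equiv.sumCongr (σ.subtypeEquiv fun _ => not_congr (by rw [← hi, σ.injective.eq_iff])) τ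

/-- `({∗} \ {∗}) ⊔ J = J`. -/
def unitLeftEquiv (J : Type) : ({x : Unit // x ≠ ()} ⊕ J) ≃ J where
  toFun
    | .inl x => (x.2 rfl).elim
    | .inr y => y
  invFun := .inr
  left_inv := by
    rintro (⟨x, hx⟩ | y)
    · exact (hx rfl).elim
    · rfl
  right_inv _ := rfl

open Classical in
/-- `(I \ {i}) ⊔ {∗} = I`, where `∗` takes the place of `i`. -/
noncomputable def unitRightEquiv {I : Type} (i : I) : ({x : I // x ≠ i} ⊕ Unit) ≃ I where
  toFun
    | .inl x => x.1
    | .inr _ => i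
  invFun x := if h : x = i then .inr () else .inl ⟨x, h⟩
  left_inv := by
    rintro (⟨x, hx⟩ | y)
    · simp [hx]
    · simp
  right_inv x := by
    by_cases h : x = i
    · simp [h]
    · simp [h]

/-- `(((I \ {i}) ⊔ J) \ {j}) ⊔ L = (I \ {i}) ⊔ ((J \ {j}) ⊔ L)` for `j ∈ J`. -/
def seqEquiv {I J : Type} (L : Type) (i : I) (j : J) :
    ({w : {x : I // x ≠ i} ⊕ J // w ≠ .inr j} ⊕ L) ≃
      ({x : I // x ≠ i} ⊕ ({y : J // y ≠ j} ⊕ L)) where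
  toFun
    | .inl ⟨.inl x, _⟩ => .inl x
    | .inl ⟨.inr y, h⟩ => .inr (.inl ⟨y, fun e => h (congrArg _ e)⟩)
    | .inr l => .inr (.inr l)
  invFun
    | .inl x => .inl ⟨.inl x, Sum.inl_ne_inr⟩
    | .inr (.inl y) => .inl ⟨.inr y.1, fun e => y.2 (Sum.inr_injective e)⟩
    | .inr (.inr l) => .inr l
  left_inv := by rintro (⟨x | y, h⟩ | l) <;> rfl
  right_inv := by rintro (x | y | l) <;> rfl

/-- `(((I \ {i}) ⊔ J) \ {i'}) ⊔ L = (((I \ {i'}) ⊔ L) \ {i}) ⊔ J` for `i ≠ i'` in `I`. -/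
def parEquiv {I : Type} (J L : Type) {i i' : I} (h : i' ≠ i) :
    ({w : {x : I // x ≠ i} ⊕ J // w ≠ .inl ⟨i', h⟩} ⊕ L) ≃
      ({w : {x : I // x ≠ i'} ⊕ L // w ≠ .inl ⟨i, h.symm⟩} ⊕ J) where
  toFun
    | .inl ⟨.inl x, hx⟩ =>
        .inl ⟨.inl ⟨x.1, fun e => hx (congrArg _ (Subtype.ext e))⟩,
          fun e => x.2 (congrArg Subtype.val (Sum.inl_injective e))⟩
    | .inl ⟨.inr y, _⟩ => .inr y
    | .inr l => .inl ⟨.inr l, Sum.inr_ne_inl⟩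
  invFun
    | .inl ⟨.inl x, hx⟩ =>
        .inl ⟨.inl ⟨x.1, fun e => hx (congrArg _ (Subtype.ext e))⟩,
          fun e => x.2 (congrArg Subtype.val (Sum.inl_injective e))⟩
    | .inl ⟨.inr l, _⟩ => .inr l
    | .inr y => .inl ⟨.inr y, Sum.inr_ne_inl⟩
  left_inv := by rintro (⟨x | y, hx⟩ | l) <;> rfl
  right_inv := by rintro (⟨x | l, hx⟩ | y) <;> rfl

/-- A differential graded (symmetric) operad: an operad in the symmetric monoidal category of
complexes of `ℤ`-modules.  `obj I k` is the degree `k` part of the complex attached to the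
finite set `I`, and `comp i x y` is `x ∘_i y`, an element attached to `(I \ {i}) ⊔ J`. -/
structure DGOperad where
  obj : (I : Type) → [Finite I] → ℤ → Type 1
  [grp : ∀ (I : Type) [Finite I] (k : ℤ), AddCommGroup (obj I k)]
  /-- the differential -/
  d : ∀ {I : Type} [Finite I] {k : ℤ}, obj I k →+ obj I (k + 1)
  /-- the action of bijections -/
  map : ∀ {I J : Type} [Finite I] [Finite J] {k : ℤ}, (I ≃ J) → (obj I k →+ obj J k)
  /-- the unit -/
  one : obj Unit 0
  /-- the partial compositions -/
  comp : ∀ {I J : Type} [Finite I] [Finite J] {a b c : ℤ} (i : I), a + b = c →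
    (obj I a →+ obj J b →+ obj ({x : I // x ≠ i} ⊕ J) c)
  d_d : ∀ {I : Type} [Finite I] {k : ℤ} (x : obj I k), d (d x) = 0
  map_refl : ∀ {I : Type} [Finite I] {k : ℤ} (x : obj I k), map (Equiv.refl I) x = x
  map_trans : ∀ {I J L : Type} [Finite I] [Finite J] [Finite L] {k : ℤ} (σ : I ≃ J) (τ : J ≃ L)
    (x : obj I k), map (σ.trans τ) x = map τ (map σ x)
  d_map : ∀ {I J : Type} [Finite I] [Finite J] {k : ℤ} (σ : I ≃ J) (x : obj I k),
    d (map σ x) = map σ (d x)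
  d_one : d one = 0
  d_comp : ∀ {I J : Type} [Finite I] [Finite J] {a b c : ℤ} (i : I) (h : a + b = c)
    (x : obj I a) (y : obj J b),
    d (comp i h x y) =
      comp i (by omega) (d x) y + a.negOnePow • comp i (by omega) x (d y)
  map_comp : ∀ {I I' J J' : Type} [Finite I] [Finite I'] [Finite J] [Finite J'] {a b c : ℤ}
    (σ : I ≃ I') (τ : J ≃ J') {i : I} {i' : I'} (hi : σ i = i') (h : a + b = c)
    (x : obj I a) (y : obj J b),
    map (relabelEquiv σ τ hi) (comp i h x y) = comp i' h (map σ x) (map τ y)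
  one_comp : ∀ {J : Type} [Finite J] {b : ℤ} (y : obj J b),
    map (unitLeftEquiv J) (comp () (zero_add b) one y) = y
  comp_one : ∀ {I : Type} [Finite I] {a : ℤ} (i : I) (x : obj I a),
    map (unitRightEquiv i) (comp i (add_zero a) x one) = x
  comp_seq : ∀ {I J L : Type} [Finite I] [Finite J] [Finite L] {a b c e f g : ℤ} (i : I) (j : J)
    (h₁ : a + b = e) (h₂ : e + c = g) (h₃ : b + c = f) (h₄ : a + f = g)
    (x : obj I a) (y : obj J b) (z : obj L c),
    map (seqEquiv L i j) (comp (.inr j) h₂ (comp i h₁ x y) z) = comp i h₄ x (comp j h₃ y z)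
  comp_par : ∀ {I J L : Type} [Finite I] [Finite J] [Finite L] {a b c e f g : ℤ} {i i' : I}
    (hi : i' ≠ i) (h₁ : a + b = e) (h₂ : e + c = g) (h₃ : a + c = f) (h₄ : f + b = g)
    (x : obj I a) (y : obj J b) (z : obj L c),
    map (parEquiv J L hi) (comp (.inl ⟨i', hi⟩) h₂ (comp i h₁ x y) z) =
      (b * c).negOnePow • comp (.inl ⟨i, hi.symm⟩) h₄ (comp i' h₃ x z) y

attribute [instance] DGOperad.grp

/-- The element obtained from a binary element by exchanging its two inputs. -/
def DGOperad.swap (P : DGOperad) {k : ℤ} (x : P.obj (Fin 2) k) : P.obj (Fin 2) k :=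
  P.map (Equiv.swap 0 1) x

/-- Morphisms of differential graded operads. -/
@[ext]
structure Hom (P Q : DGOperad) where
  app : ∀ {I : Type} [Finite I] {k : ℤ}, P.obj I k →+ Q.obj I k
  app_d : ∀ {I : Type} [Finite I] {k : ℤ} (x : P.obj I k), app (P.d x) = Q.d (app x)
  app_map : ∀ {I J : Type} [Finite I] [Finite J] {k : ℤ} (σ : I ≃ J) (x : P.obj I k),
    app (P.map σ x) = Q.map σ (app x)
  app_one : app P.one = Q.one
  app_comp : ∀ {I J : Type} [Finite I] [Finite J] {a b c : ℤ} (i : I) (h : a + b = c)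
    (x : P.obj I a) (y : P.obj J b), app (P.comp i h x y) = Q.comp i h (app x) (app y)

/-- Composition of morphisms of differential graded operads. -/
def Hom.comp {P Q R : DGOperad} (g : Hom Q R) (f : Hom P Q) : Hom P R where
  app := g.app.comp f.app
  app_d x := by simp [f.app_d, g.app_d]
  app_map σ x := by simp [f.app_map, g.app_map]
  app_one := by simp [f.app_one, g.app_one]
  app_comp i h x y := by simp [f.app_comp, g.app_comp]

/-! ## Operads presented by binary generators and relations

The differential graded operad with generators `g : G` (binary, of degree `deg g`) and given
relations is built as the set of all formal expressions in the generators and the operations of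
a differential graded operad, modulo the smallest congruence that contains the given relations
and makes the laws of a differential graded operad hold.  Symmetries and differentials of the
generators are listed among the relations. -/

/-- Formal expressions. -/
inductive Expr {G : Type} (deg : G → ℤ) : Type → ℤ → Type 1
  | gen (g : G) : Expr deg (Fin 2) (deg g)
  | one : Expr deg Unit 0
  | map {I J : Type} [Finite I] [Finite J] {k : ℤ} (σ : I ≃ J) (x : Expr deg I k) : Expr deg J k
  | comp {I J : Type} [Finite I] [Finite J] {a b c : ℤ} (i : I) (h : a + b = c)
      (x : Expr deg I a) (y : Expr deg J b) : Expr deg ({x : I // x ≠ i} ⊕ J) c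
  | d {I : Type} {k : ℤ} (x : Expr deg I k) : Expr deg I (k + 1)
  | zero {I : Type} {k : ℤ} : Expr deg I k
  | add {I : Type} {k : ℤ} (x y : Expr deg I k) : Expr deg I k
  | neg {I : Type} {k : ℤ} (x : Expr deg I k) : Expr deg I k

section Presented

variable {G : Type} {deg : G → ℤ}

instance {I : Type} {k : ℤ} : Zero (Expr deg I k) := ⟨.zero⟩
instance {I : Type} {k : ℤ} : Add (Expr deg I k) := ⟨.add⟩
instance {I : Type} {k : ℤ} : Neg (Expr deg I k) := ⟨.neg⟩
instance {I : Type} {k : ℤ} : Sub (Expr deg I k) := ⟨fun x y => x + -y⟩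

/-- `(-1)^n x`. -/
def Expr.sign {I : Type} {k : ℤ} (n : ℤ) (x : Expr deg I k) : Expr deg I k :=
  if Even n then x else -x

/-- The congruence generated by a family of relations and the laws of a differential graded
operad. -/
inductive Cong (R : ∀ ⦃I : Type⦄ ⦃k : ℤ⦄, Expr deg I k → Expr deg I k → Prop) :
    ∀ {I : Type} {k : ℤ}, Expr deg I k → Expr deg I k → Prop
  -- the given relations
  | of {I : Type} {k : ℤ} {x y : Expr deg I k} : R x y → Cong R x y
  -- equivalence relation
  | refl {I : Type} {k : ℤ} (x : Expr deg I k) : Cong R x x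
  | symm {I : Type} {k : ℤ} {x y : Expr deg I k} : Cong R x y → Cong R y x
  | trans {I : Type} {k : ℤ} {x y z : Expr deg I k} : Cong R x y → Cong R y z → Cong R x z
  -- compatibility with the operations
  | map_congr {I J : Type} [Finite I] [Finite J] {k : ℤ} (σ : I ≃ J) {x y : Expr deg I k} :
      Cong R x y → Cong R (.map σ x) (.map σ y)
  | comp_congr {I J : Type} [Finite I] [Finite J] {a b c : ℤ} (i : I) (h : a + b = c)
      {x x' : Expr deg I a} {y y' : Expr deg J b} :
      Cong R x x' → Cong R y y' → Cong R (.comp i h x y) (.comp i h x' y')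
  | d_congr {I : Type} {k : ℤ} {x y : Expr deg I k} : Cong R x y → Cong R (.d x) (.d y)
  | add_congr {I : Type} {k : ℤ} {x x' y y' : Expr deg I k} :
      Cong R x x' → Cong R y y' → Cong R (x + y) (x' + y')
  | neg_congr {I : Type} {k : ℤ} {x y : Expr deg I k} : Cong R x y → Cong R (-x) (-y)
  -- abelian groups
  | add_assoc {I : Type} {k : ℤ} (x y z : Expr deg I k) : Cong R (x + y + z) (x + (y + z))
  | add_comm {I : Type} {k : ℤ} (x y : Expr deg I k) : Cong R (x + y) (y + x)
  | zero_add {I : Type} {k : ℤ} (x : Expr deg I k) : Cong R (0 + x) x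
  | neg_add {I : Type} {k : ℤ} (x : Expr deg I k) : Cong R (-x + x) 0
  -- additivity
  | map_add {I J : Type} [Finite I] [Finite J] {k : ℤ} (σ : I ≃ J) (x y : Expr deg I k) :
      Cong R (.map σ (x + y)) (.map σ x + .map σ y)
  | d_add {I : Type} {k : ℤ} (x y : Expr deg I k) : Cong R (.d (x + y)) (.d x + .d y)
  | comp_add_left {I J : Type} [Finite I] [Finite J] {a b c : ℤ} (i : I) (h : a + b = c)
      (x x' : Expr deg I a) (y : Expr deg J b) :
      Cong R (.comp i h (x + x') y) (.comp i h x y + .comp i h x' y)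
  | comp_add_right {I J : Type} [Finite I] [Finite J] {a b c : ℤ} (i : I) (h : a + b = c)
      (x : Expr deg I a) (y y' : Expr deg J b) :
      Cong R (.comp i h x (y + y')) (.comp i h x y + .comp i h x y')
  -- differential graded operads
  | d_d {I : Type} {k : ℤ} (x : Expr deg I k) : Cong R (.d (.d x)) 0
  | map_refl {I : Type} [Finite I] {k : ℤ} (x : Expr deg I k) : Cong R (.map (Equiv.refl I) x) x
  | map_trans {I J L : Type} [Finite I] [Finite J] [Finite L] {k : ℤ} (σ : I ≃ J) (τ : J ≃ L)
      (x : Expr deg I k) : Cong R (.map (σ.trans τ) x) (.map τ (.map σ x))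
  | d_map {I J : Type} [Finite I] [Finite J] {k : ℤ} (σ : I ≃ J) (x : Expr deg I k) :
      Cong R (.d (.map σ x)) (.map σ (.d x))
  | d_one : Cong R (.d .one) 0
  | d_comp {I J : Type} [Finite I] [Finite J] {a b c : ℤ} (i : I) (h : a + b = c)
      (h₁ : a + 1 + b = c + 1) (h₂ : a + (b + 1) = c + 1) (x : Expr deg I a) (y : Expr deg J b) :
      Cong R (.d (.comp i h x y)) (.comp i h₁ (.d x) y + Expr.sign a (.comp i h₂ x (.d y)))
  | map_comp {I I' J J' : Type} [Finite I] [Finite I'] [Finite J] [Finite J'] {a b c : ℤ}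
      (σ : I ≃ I') (τ : J ≃ J') {i : I} {i' : I'} (hi : σ i = i') (h : a + b = c)
      (x : Expr deg I a) (y : Expr deg J b) :
      Cong R (.map (relabelEquiv σ τ hi) (.comp i h x y)) (.comp i' h (.map σ x) (.map τ y))
  | one_comp {J : Type} [Finite J] {b : ℤ} (h : 0 + b = b) (y : Expr deg J b) :
      Cong R (.map (unitLeftEquiv J) (.comp () h .one y)) y
  | comp_one {I : Type} [Finite I] {a : ℤ} (h : a + 0 = a) (i : I) (x : Expr deg I a) :
      Cong R (.map (unitRightEquiv i) (.comp i h x .one)) x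
  | comp_seq {I J L : Type} [Finite I] [Finite J] [Finite L] {a b c e f g : ℤ} (i : I) (j : J)
      (h₁ : a + b = e) (h₂ : e + c = g) (h₃ : b + c = f) (h₄ : a + f = g)
      (x : Expr deg I a) (y : Expr deg J b) (z : Expr deg L c) :
      Cong R (.map (seqEquiv L i j) (.comp (.inr j) h₂ (.comp i h₁ x y) z))
        (.comp i h₄ x (.comp j h₃ y z))
  | comp_par {I J L : Type} [Finite I] [Finite J] [Finite L] {a b c e f g : ℤ} {i i' : I}
      (hi : i' ≠ i) (h₁ : a + b = e) (h₂ : e + c = g) (h₃ : a + c = f) (h₄ : f + b = g)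
      (x : Expr deg I a) (y : Expr deg J b) (z : Expr deg L c) :
      Cong R (.map (parEquiv J L hi) (.comp (.inl ⟨i', hi⟩) h₂ (.comp i h₁ x y) z))
        (Expr.sign (b * c) (.comp (.inl ⟨i, hi.symm⟩) h₄ (.comp i' h₃ x z) y))

variable (R : ∀ ⦃I : Type⦄ ⦃k : ℤ⦄, Expr deg I k → Expr deg I k → Prop)

/-- The congruence as a setoid. -/
def congSetoid (I : Type) (k : ℤ) : Setoid (Expr deg I k) where
  r := Cong R
  iseqv := ⟨.refl, .symm, .trans⟩

/-- The degree `k` part of the presented operad on the finite set `I`. -/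
def PObj (I : Type) (k : ℤ) : Type 1 := Quotient (congSetoid R I k)

/-- The class of an expression. -/
def PObj.mk {I : Type} {k : ℤ} (x : Expr deg I k) : PObj R I k := Quotient.mk (congSetoid R I k) x

instance (I : Type) (k : ℤ) : Zero (PObj R I k) := ⟨PObj.mk R 0⟩
instance (I : Type) (k : ℤ) : Add (PObj R I k) :=
  ⟨Quotient.map₂ (· + ·) fun _ _ h _ _ h' => Cong.add_congr h h'⟩
instance (I : Type) (k : ℤ) : Neg (PObj R I k) := ⟨Quotient.map (- ·) fun _ _ h => Cong.neg_congr h⟩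

instance (I : Type) (k : ℤ) : AddCommGroup (PObj R I k) where
  add_assoc := by
    rintro ⟨x⟩ ⟨y⟩ ⟨z⟩
    exact Quotient.sound (Cong.add_assoc x y z)
  add_comm := by
    rintro ⟨x⟩ ⟨y⟩
    exact Quotient.sound (Cong.add_comm x y)
  zero_add := by
    rintro ⟨x⟩
    exact Quotient.sound (Cong.zero_add x)
  add_zero := by
    rintro ⟨x⟩
    exact Quotient.sound ((Cong.add_comm x 0).trans (Cong.zero_add x))
  neg_add_cancel := by
    rintro ⟨x⟩
    exact Quotient.sound (Cong.neg_add x)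
  nsmul := nsmulRec
  zsmul := zsmulRec

theorem PObj.mk_sign {I : Type} {k : ℤ} (n : ℤ) (x : Expr deg I k) :
    PObj.mk R (Expr.sign n x) = n.negOnePow • PObj.mk R x := by
  by_cases h : Even n
  · simp [Expr.sign, h, Int.negOnePow_even n h]
  · rw [Int.negOnePow_odd n (Int.not_even_iff_odd.1 h), Units.neg_smul, one_smul]
    simp only [Expr.sign, h, if_false]
    rfl

/-- The differential graded operad presented by the binary generators `g : G`, of degree `deg g`,
and the relations `R`. -/
noncomputable def presented : DGOperad where
  obj I _ k := PObj R I k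
  d := AddMonoidHom.mk' (Quotient.map .d fun _ _ h => Cong.d_congr h) (by
    rintro ⟨x⟩ ⟨y⟩
    exact Quotient.sound (Cong.d_add x y))
  map σ := AddMonoidHom.mk' (Quotient.map (.map σ) fun _ _ h => Cong.map_congr σ h) (by
    rintro ⟨x⟩ ⟨y⟩
    exact Quotient.sound (Cong.map_add σ x y))
  one := PObj.mk R .one
  comp i h := AddMonoidHom.mk' (fun x => AddMonoidHom.mk'
      (fun y => Quotient.map₂ (.comp i h) (fun _ _ h₁ _ _ h₂ => Cong.comp_congr i h h₁ h₂) x y) (by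
        revert x
        rintro ⟨x⟩ ⟨y⟩ ⟨y'⟩
        exact Quotient.sound (Cong.comp_add_right i h x y y'))) (by
    rintro ⟨x⟩ ⟨x'⟩
    ext ⟨y⟩
    exact Quotient.sound (Cong.comp_add_left i h x x' y))
  d_d := by
    rintro I _ k ⟨x⟩
    exact Quotient.sound (Cong.d_d x)
  map_refl := by
    rintro I _ k ⟨x⟩
    exact Quotient.sound (Cong.map_refl x)
  map_trans := by
    rintro I J L _ _ _ k σ τ ⟨x⟩
    exact Quotient.sound (Cong.map_trans σ τ x)
  d_map := by
    rintro I J _ _ k σ ⟨x⟩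
    exact Quotient.sound (Cong.d_map σ x)
  d_one := Quotient.sound Cong.d_one
  d_comp := by
    rintro I J _ _ a b c i h ⟨x⟩ ⟨y⟩
    refine (Quotient.sound (Cong.d_comp i h (by omega) (by omega) x y)).trans ?_
    exact congrArg (PObj.mk R (.comp i (by omega) (.d x) y) + ·)
      (PObj.mk_sign R a (.comp i (by omega) x (.d y)))
  map_comp := by
    rintro I I' J J' _ _ _ _ a b c σ τ i i' hi h ⟨x⟩ ⟨y⟩
    exact Quotient.sound (Cong.map_comp σ τ hi h x y)
  one_comp := by
    rintro J _ b ⟨y⟩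
    exact Quotient.sound (Cong.one_comp _ y)
  comp_one := by
    rintro I _ a i ⟨x⟩
    exact Quotient.sound (Cong.comp_one _ i x)
  comp_seq := by
    rintro I J L _ _ _ a b c e f g i j h₁ h₂ h₃ h₄ ⟨x⟩ ⟨y⟩ ⟨z⟩
    exact Quotient.sound (Cong.comp_seq i j h₁ h₂ h₃ h₄ x y z)
  comp_par := by
    rintro I J L _ _ _ a b c e f g i i' hi h₁ h₂ h₃ h₄ ⟨x⟩ ⟨y⟩ ⟨z⟩
    exact (Quotient.sound (Cong.comp_par hi h₁ h₂ h₃ h₄ x y z)).trans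
      (PObj.mk_sign R (b * c) _)

/-- The generators, as elements of the presented operad. -/
noncomputable def presented.gen (g : G) : (presented R).obj (Fin 2) (deg g) := PObj.mk R (.gen g)

/-- `({1,2} \ {1}) ⊔ {1,2} = {1,2,3}` for the composition at the input `1`. -/
def circ₁Equiv : ({x : Fin 2 // x ≠ 0} ⊕ Fin 2) ≃ Fin 3 where
  toFun
    | .inl _ => 2
    | .inr 0 => 0
    | .inr 1 => 1
  invFun
    | 0 => .inr 0
    | 1 => .inr 1
    | 2 => .inl ⟨1, by decide⟩
  left_inv := by decide
  right_inv := by decide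

/-- `({1,2} \ {2}) ⊔ {1,2} = {1,2,3}` for the composition at the input `2`. -/
def circ₂Equiv : ({x : Fin 2 // x ≠ 1} ⊕ Fin 2) ≃ Fin 3 where
  toFun
    | .inl _ => 0
    | .inr 0 => 1
    | .inr 1 => 2
  invFun
    | 0 => .inl ⟨0, by decide⟩
    | 1 => .inr 0
    | 2 => .inr 1
  left_inv := by decide
  right_inv := by decide

namespace Expr

/-- The composition `x ∘₁ y` of binary operations, with inputs numbered from left to right:
`x(y(1,2),3)`. -/
def circ₁ {a b c : ℤ} (x : Expr deg (Fin 2) a) (y : Expr deg (Fin 2) b)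
    (h : a + b = c := by decide) : Expr deg (Fin 3) c :=
  .map circ₁Equiv (.comp 0 h x y)

/-- The composition `x ∘₂ y` of binary operations, with inputs numbered from left to right:
`x(1,y(2,3))`. -/
def circ₂ {a b c : ℤ} (x : Expr deg (Fin 2) a) (y : Expr deg (Fin 2) b)
    (h : a + b = c := by decide) : Expr deg (Fin 3) c :=
  .map circ₂Equiv (.comp 1 h x y)

/-- Exchange of the two inputs. -/
def swap {k : ℤ} (x : Expr deg (Fin 2) k) : Expr deg (Fin 2) k := .map (Equiv.swap 0 1) x

/-- Action of the cycle `3 → 2 → 1 → 3` on the labels of the inputs. -/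
def tau {k : ℤ} (x : Expr deg (Fin 3) k) : Expr deg (Fin 3) k := .map (finRotate 3).symm x

/-- Exchange of the inputs `2` and `3`. -/
def swap₂₃ {k : ℤ} (x : Expr deg (Fin 3) k) : Expr deg (Fin 3) k := .map (Equiv.swap 1 2) x

end Expr

end Presented

open DGOp.Expr

/-! ## The fifteen operads -/

/-! ### First row: `Zin`, `Dend`, `PreLie` (zero differential) -/

/-- Generator `x ≺ y` of `Zin`. -/
inductive ZinGen | prec
def ZinGen.deg : ZinGen → ℤ | prec => 0
abbrev ZinGen.ePrec : Expr ZinGen.deg (Fin 2) 0 := .gen prec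

open ZinGen in
/-- `(x ≺ y) ≺ z = x ≺ (y ≺ z) + x ≺ (z ≺ y)`. -/
inductive ZinRel : ∀ ⦃I : Type⦄ ⦃k : ℤ⦄, Expr deg I k → Expr deg I k → Prop
  | d_prec : ZinRel (.d ePrec) 0
  | zinbiel : ZinRel (k := 0) (circ₁ ePrec ePrec) (circ₂ ePrec ePrec + circ₂ ePrec (swap ePrec))

/-- The operad of zinbiel algebras. -/
noncomputable def Zin : DGOperad := presented ZinRel
noncomputable def Zin.prec : Zin.obj (Fin 2) 0 := presented.gen ZinRel .prec

/-- Generators `x ≺ y` and `x ≻ y` of `Dend`. -/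
inductive DendGen | prec | succ
def DendGen.deg : DendGen → ℤ | prec => 0 | succ => 0
abbrev DendGen.ePrec : Expr DendGen.deg (Fin 2) 0 := .gen prec
abbrev DendGen.eSucc : Expr DendGen.deg (Fin 2) 0 := .gen succ

open DendGen in
/-- `x ≻ (y ≺ z) = (x ≻ y) ≺ z`, `x ≻ (y ≻ z) = (x ≻ y) ≻ z + (x ≺ y) ≻ z` and
`(x ≺ y) ≺ z = x ≺ (y ≺ z) + x ≺ (y ≻ z)`. -/
inductive DendRel : ∀ ⦃I : Type⦄ ⦃k : ℤ⦄, Expr deg I k → Expr deg I k → Prop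
  | d_prec : DendRel (.d ePrec) 0
  | d_succ : DendRel (.d eSucc) 0
  | dend₁ : DendRel (k := 0) (circ₂ eSucc ePrec) (circ₁ ePrec eSucc)
  | dend₂ : DendRel (k := 0) (circ₂ eSucc eSucc) (circ₁ eSucc eSucc + circ₁ eSucc ePrec)
  | dend₃ : DendRel (k := 0) (circ₁ ePrec ePrec) (circ₂ ePrec ePrec + circ₂ ePrec eSucc)

/-- The operad of dendriform algebras. -/
noncomputable def Dend : DGOperad := presented DendRel
noncomputable def Dend.prec : Dend.obj (Fin 2) 0 := presented.gen DendRel .prec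
noncomputable def Dend.succ : Dend.obj (Fin 2) 0 := presented.gen DendRel .succ

/-- Generator `x ↶ y` of `PreLie`. -/
inductive PreLieGen | graft
def PreLieGen.deg : PreLieGen → ℤ | graft => 0
abbrev PreLieGen.eGraft : Expr PreLieGen.deg (Fin 2) 0 := .gen graft

open PreLieGen in
/-- `(x ↶ y) ↶ z - x ↶ (y ↶ z) = (x ↶ z) ↶ y - x ↶ (z ↶ y)`. -/
inductive PreLieRel : ∀ ⦃I : Type⦄ ⦃k : ℤ⦄, Expr deg I k → Expr deg I k → Prop
  | d_graft : PreLieRel (.d eGraft) 0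
  | preLie : PreLieRel (k := 0) (circ₁ eGraft eGraft - circ₂ eGraft eGraft)
      (swap₂₃ (circ₁ eGraft eGraft - circ₂ eGraft eGraft))

/-- The operad of (right) pre-Lie algebras. -/
noncomputable def PreLie : DGOperad := presented PreLieRel
noncomputable def PreLie.graft : PreLie.obj (Fin 2) 0 := presented.gen PreLieRel .graft

/-! ### Second row: `Π`, `K`, `Λ` -/

/-- Generators `1 ⊗ 2` (dimension `0`) and `1 ∧ 2` (dimension `1`) of `Π`. -/
inductive PermutoGen | tens | wedge
def PermutoGen.deg : PermutoGen → ℤ | tens => 0 | wedge => 1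
abbrev PermutoGen.eTens : Expr PermutoGen.deg (Fin 2) 0 := .gen tens
abbrev PermutoGen.eWedge : Expr PermutoGen.deg (Fin 2) 1 := .gen wedge

open PermutoGen in
/-- The relations of `Π`. -/
inductive PermutoRel : ∀ ⦃I : Type⦄ ⦃k : ℤ⦄, Expr deg I k → Expr deg I k → Prop
  | wedge_antisymm : PermutoRel (swap eWedge) (-eWedge)
  | d_tens : PermutoRel (k := 1) (.d eTens) eWedge
  | d_wedge : PermutoRel (.d eWedge) 0
  | rel₁ : PermutoRel (k := 0) (circ₁ eTens eTens) (circ₂ eTens eTens + circ₂ eTens (swap eTens))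
  | rel₂ : PermutoRel (k := 1) (circ₂ eWedge eTens) (circ₁ eTens eWedge)
  | rel₂' : PermutoRel (k := 1) (circ₁ eTens eWedge) (tau (circ₁ eWedge (swap eTens)))
  | rel₃ : PermutoRel (k := 2) (circ₁ (swap eWedge) eWedge) (circ₂ eWedge eWedge)

/-- The operad `Π` of permutohedra. -/
noncomputable def Permuto : DGOperad := presented PermutoRel
noncomputable def Permuto.tens : Permuto.obj (Fin 2) 0 := presented.gen PermutoRel .tens
noncomputable def Permuto.wedge : Permuto.obj (Fin 2) 1 := presented.gen PermutoRel .wedge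

/-- Generators `1 < 2`, `1 > 2` (dimension `0`) and `1 | 2` (dimension `1`) of `K`. -/
inductive KGen | lt | gt | bar
def KGen.deg : KGen → ℤ | lt => 0 | gt => 0 | bar => 1
abbrev KGen.eLt : Expr KGen.deg (Fin 2) 0 := .gen lt
abbrev KGen.eGt : Expr KGen.deg (Fin 2) 0 := .gen gt
abbrev KGen.eBar : Expr KGen.deg (Fin 2) 1 := .gen bar

open KGen in
/-- The relations of `K`. -/
inductive KRel : ∀ ⦃I : Type⦄ ⦃k : ℤ⦄, Expr deg I k → Expr deg I k → Prop
  | d_lt : KRel (k := 1) (.d eLt) eBar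
  | d_gt : KRel (k := 1) (.d eGt) (-eBar)
  | d_bar : KRel (.d eBar) 0
  | rel₁ : KRel (k := 0) (circ₂ eGt eLt) (circ₁ eLt eGt)
  | rel₂ : KRel (k := 0) (circ₂ eGt eGt) (circ₁ eGt eGt + circ₁ eGt eLt)
  | rel₃ : KRel (k := 0) (circ₁ eLt eLt) (circ₂ eLt eLt + circ₂ eLt eGt)
  | rel₄ : KRel (k := 1) (circ₂ eGt eBar) (circ₁ eBar eGt)
  | rel₅ : KRel (k := 1) (circ₁ eLt eBar) (circ₂ eBar eLt)
  | rel₆ : KRel (k := 1) (circ₁ eBar eLt) (circ₂ eBar eGt)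
  | rel₇ : KRel (k := 2) (circ₁ eBar eBar) (-circ₂ eBar eBar)

/-- The (symmetric) operad `K` of associahedra. -/
noncomputable def K : DGOperad := presented KRel
noncomputable def K.lt : K.obj (Fin 2) 0 := presented.gen KRel .lt
noncomputable def K.gt : K.obj (Fin 2) 0 := presented.gen KRel .gt
noncomputable def K.bar : K.obj (Fin 2) 1 := presented.gen KRel .bar

/-- Generators `1 ↶ 2` (dimension `0`) and `[1,2]` (dimension `1`) of `Λ`. -/
inductive LambdaGen | graft | bracket
def LambdaGen.deg : LambdaGen → ℤ | graft => 0 | bracket => 1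
abbrev LambdaGen.eGraft : Expr LambdaGen.deg (Fin 2) 0 := .gen graft
abbrev LambdaGen.eBracket : Expr LambdaGen.deg (Fin 2) 1 := .gen bracket

open LambdaGen in
/-- The relations of `Λ`: `[1,2]` is symmetric, `↶` is (right) pre-Lie,
`[1,2] ↶ 3 = [1 ↶ 3, 2] + [1, 2 ↶ 3]`, and the Jacobi identity. -/
inductive LambdaRel : ∀ ⦃I : Type⦄ ⦃k : ℤ⦄, Expr deg I k → Expr deg I k → Prop
  | bracket_symm : LambdaRel (swap eBracket) eBracket
  | d_graft : LambdaRel (k := 1) (.d eGraft) eBracket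
  | d_bracket : LambdaRel (.d eBracket) 0
  | preLie : LambdaRel (k := 0) (circ₁ eGraft eGraft - circ₂ eGraft eGraft)
      (swap₂₃ (circ₁ eGraft eGraft - circ₂ eGraft eGraft))
  | deriv : LambdaRel (k := 1) (circ₁ eGraft eBracket)
      (swap₂₃ (circ₁ eBracket eGraft) + circ₂ eBracket eGraft)
  | jacobi : LambdaRel (k := 2) (circ₁ eBracket eBracket + tau (circ₁ eBracket eBracket)
      + tau (tau (circ₁ eBracket eBracket))) 0

/-- The operad `Λ`. -/
noncomputable def Lambda : DGOperad := presented LambdaRel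
noncomputable def Lambda.graft : Lambda.obj (Fin 2) 0 := presented.gen LambdaRel .graft
noncomputable def Lambda.bracket : Lambda.obj (Fin 2) 1 := presented.gen LambdaRel .bracket

/-! ### Third row: `Com`, `As`, `Lie` (zero differential) -/

/-- Generator of `Com`. -/
inductive ComGen | mul
def ComGen.deg : ComGen → ℤ | mul => 0
abbrev ComGen.eMul : Expr ComGen.deg (Fin 2) 0 := .gen mul

open ComGen in
/-- Commutativity and associativity. -/
inductive ComRel : ∀ ⦃I : Type⦄ ⦃k : ℤ⦄, Expr deg I k → Expr deg I k → Prop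
  | mul_symm : ComRel (swap eMul) eMul
  | d_mul : ComRel (.d eMul) 0
  | assoc : ComRel (k := 0) (circ₁ eMul eMul) (circ₂ eMul eMul)

/-- The operad of commutative associative algebras. -/
noncomputable def Com : DGOperad := presented ComRel
noncomputable def Com.mul : Com.obj (Fin 2) 0 := presented.gen ComRel .mul

/-- Generator of `As`. -/
inductive AsGen | mul
def AsGen.deg : AsGen → ℤ | mul => 0
abbrev AsGen.eMul : Expr AsGen.deg (Fin 2) 0 := .gen mul

open AsGen in
/-- Associativity. -/
inductive AsRel : ∀ ⦃I : Type⦄ ⦃k : ℤ⦄, Expr deg I k → Expr deg I k → Prop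
  | d_mul : AsRel (.d eMul) 0
  | assoc : AsRel (k := 0) (circ₁ eMul eMul) (circ₂ eMul eMul)

/-- The operad of associative algebras. -/
noncomputable def As : DGOperad := presented AsRel
noncomputable def As.mul : As.obj (Fin 2) 0 := presented.gen AsRel .mul

/-- Generator of `Lie`. -/
inductive LieGen | bracket
def LieGen.deg : LieGen → ℤ | bracket => 0
abbrev LieGen.eBracket : Expr LieGen.deg (Fin 2) 0 := .gen bracket

open LieGen in
/-- Antisymmetry and the Jacobi identity. -/
inductive LieRel : ∀ ⦃I : Type⦄ ⦃k : ℤ⦄, Expr deg I k → Expr deg I k → Prop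
  | bracket_antisymm : LieRel (swap eBracket) (-eBracket)
  | d_bracket : LieRel (.d eBracket) 0
  | jacobi : LieRel (k := 0) (circ₁ eBracket eBracket + tau (circ₁ eBracket eBracket)
      + tau (tau (circ₁ eBracket eBracket))) 0

/-- The operad of Lie algebras. -/
noncomputable def Lie : DGOperad := presented LieRel
noncomputable def Lie.bracket : Lie.obj (Fin 2) 0 := presented.gen LieRel .bracket

/-! ### Fourth row: `Pasc`, `Trias`, `⨿`

These are chain complexes: dimension `1` is degree `-1`. -/

/-- Generators `e₁` (dimension `0`) and `e₁ ∧ e₂` (dimension `1`) of `Pasc`; `e₂` is the image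
of `e₁` under the exchange of `1` and `2`. -/
inductive PascGen | e | wedge
def PascGen.deg : PascGen → ℤ | e => 0 | wedge => -1
abbrev PascGen.e₁ : Expr PascGen.deg (Fin 2) 0 := .gen e
abbrev PascGen.e₂ : Expr PascGen.deg (Fin 2) 0 := swap e₁
abbrev PascGen.e₁₂ : Expr PascGen.deg (Fin 2) (-1) := .gen wedge

open PascGen in
/-- The relations of `Pasc`. -/
inductive PascRel : ∀ ⦃I : Type⦄ ⦃k : ℤ⦄, Expr deg I k → Expr deg I k → Prop
  | wedge_antisymm : PascRel (swap e₁₂) (-e₁₂)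
  | d_wedge : PascRel (k := 0) (.d e₁₂) (e₁ - e₂)
  | d_e : PascRel (.d e₁) 0
  | rel₁ : PascRel (k := 0) (circ₁ e₁ e₁) (tau (tau (circ₁ e₂ e₁)))
  | rel₂ : PascRel (k := 0) (circ₁ e₂ e₁) (circ₁ e₂ e₂)
  | rel₃ : PascRel (k := 0) (circ₁ e₁ e₂) (tau (circ₁ e₂ e₂))
  | rel₄ : PascRel (k := -1) (circ₁ e₂ e₁₂) 0
  | rel₅ : PascRel (k := -1) (tau (circ₁ e₁₂ e₂)) (circ₁ e₁ e₁₂)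
  | rel₆ : PascRel (k := -1) (-tau (tau (circ₁ e₁₂ e₁))) (circ₁ e₁ e₁₂)
  | rel₇ : PascRel (k := -2) (circ₁ e₁₂ e₁₂) (tau (circ₁ e₁₂ e₁₂))

/-- The operad `Pasc` of simplices. -/
noncomputable def Pasc : DGOperad := presented PascRel
noncomputable def Pasc.e₁ : Pasc.obj (Fin 2) 0 := presented.gen PascRel .e
noncomputable def Pasc.e₂ : Pasc.obj (Fin 2) 0 := Pasc.swap Pasc.e₁
noncomputable def Pasc.wedge : Pasc.obj (Fin 2) (-1) := presented.gen PascRel .wedge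

/-- Generators `1 ⊣ 2`, `1 ⊢ 2` (dimension `0`) and `1 × 2` (dimension `1`) of `Trias`. -/
inductive TriasGen | dashv | vdash | cross
def TriasGen.deg : TriasGen → ℤ | dashv => 0 | vdash => 0 | cross => -1
abbrev TriasGen.eL : Expr TriasGen.deg (Fin 2) 0 := .gen dashv
abbrev TriasGen.eR : Expr TriasGen.deg (Fin 2) 0 := .gen vdash
abbrev TriasGen.eX : Expr TriasGen.deg (Fin 2) (-1) := .gen cross

open TriasGen in
/-- The relations of `Trias` (`eL` is `⊣`, `eR` is `⊢`, `eX` is `×`). -/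
inductive TriasRel : ∀ ⦃I : Type⦄ ⦃k : ℤ⦄, Expr deg I k → Expr deg I k → Prop
  | d_cross : TriasRel (k := 0) (.d eX) (eL - eR)
  | d_vdash : TriasRel (.d eR) 0
  | d_dashv : TriasRel (.d eL) 0
  | rel₁ : TriasRel (k := 0) (circ₁ eL eR) (circ₂ eR eL)
  | rel₂ : TriasRel (k := 0) (circ₂ eL eL) (circ₂ eL eR)
  | rel₃ : TriasRel (k := 0) (circ₁ eL eL) (circ₂ eL eR)
  | rel₄ : TriasRel (k := 0) (circ₁ eR eR) (circ₁ eR eL)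
  | rel₅ : TriasRel (k := 0) (circ₂ eR eR) (circ₁ eR eL)
  | rel₆ : TriasRel (k := -1) (circ₁ eX eR) (circ₂ eR eX)
  | rel₇ : TriasRel (k := -1) (circ₂ eX eL) (circ₁ eL eX)
  | rel₈ : TriasRel (k := -1) (circ₁ eX eL) (circ₂ eX eR)
  | rel₉ : TriasRel (k := -1) (circ₁ eR eX) 0
  | rel₁₀ : TriasRel (k := -1) (circ₂ eL eX) 0
  | rel₁₁ : TriasRel (k := -2) (circ₁ eX eX) (-circ₂ eX eX)

/-- The (symmetric) operad `Trias`. -/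
noncomputable def Trias : DGOperad := presented TriasRel
noncomputable def Trias.dashv : Trias.obj (Fin 2) 0 := presented.gen TriasRel .dashv
noncomputable def Trias.vdash : Trias.obj (Fin 2) 0 := presented.gen TriasRel .vdash
noncomputable def Trias.cross : Trias.obj (Fin 2) (-1) := presented.gen TriasRel .cross

/-- Generators `⟨1,2⟩` (dimension `0`) and `[1,2]` (dimension `1`) of `⨿`. -/
inductive AmalgGen | angle | bracket
def AmalgGen.deg : AmalgGen → ℤ | angle => 0 | bracket => -1
abbrev AmalgGen.eAngle : Expr AmalgGen.deg (Fin 2) 0 := .gen angle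
abbrev AmalgGen.eBracket : Expr AmalgGen.deg (Fin 2) (-1) := .gen bracket

open AmalgGen in
/-- The relations of `⨿`. -/
inductive AmalgRel : ∀ ⦃I : Type⦄ ⦃k : ℤ⦄, Expr deg I k → Expr deg I k → Prop
  | bracket_symm : AmalgRel (swap eBracket) eBracket
  | d_bracket : AmalgRel (k := 0) (.d eBracket) (eAngle + swap eAngle)
  | d_angle : AmalgRel (.d eAngle) 0
  | rel₁ : AmalgRel (k := 0) (circ₁ eAngle eAngle - tau (circ₁ eAngle (swap eAngle))
      + tau (tau (circ₁ (swap eAngle) (swap eAngle)))) 0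
  | rel₂ : AmalgRel (k := -1) (tau (tau (circ₁ eBracket eAngle))
      + tau (circ₁ eBracket (swap eAngle))) (circ₁ eAngle eBracket)
  | rel₃ : AmalgRel (k := -1) (circ₁ (swap eAngle) eBracket) 0
  | rel₄ : AmalgRel (k := -2) (circ₁ eBracket eBracket + tau (circ₁ eBracket eBracket)
      + tau (tau (circ₁ eBracket eBracket))) 0

/-- The operad `⨿`. -/
noncomputable def Amalg : DGOperad := presented AmalgRel
noncomputable def Amalg.angle : Amalg.obj (Fin 2) 0 := presented.gen AmalgRel .angle
noncomputable def Amalg.bracket : Amalg.obj (Fin 2) (-1) := presented.gen AmalgRel .bracket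

/-! ### Fifth row: `Perm`, `Dias`, `Leib` (zero differential) -/

/-- Generator of `Perm`. -/
inductive PermGen | mul
def PermGen.deg : PermGen → ℤ | mul => 0
abbrev PermGen.eMul : Expr PermGen.deg (Fin 2) 0 := .gen mul

open PermGen in
/-- `(x y) z = x (y z) = x (z y)`. -/
inductive PermRel : ∀ ⦃I : Type⦄ ⦃k : ℤ⦄, Expr deg I k → Expr deg I k → Prop
  | d_mul : PermRel (.d eMul) 0
  | assoc : PermRel (k := 0) (circ₁ eMul eMul) (circ₂ eMul eMul)
  | perm : PermRel (k := 0) (circ₂ eMul eMul) (circ₂ eMul (swap eMul))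

/-- The operad of permutative algebras (commutative dialgebras). -/
noncomputable def Perm : DGOperad := presented PermRel
noncomputable def Perm.mul : Perm.obj (Fin 2) 0 := presented.gen PermRel .mul

/-- Generators `x ⊣ y` and `x ⊢ y` of `Dias`. -/
inductive DiasGen | dashv | vdash
def DiasGen.deg : DiasGen → ℤ | dashv => 0 | vdash => 0
abbrev DiasGen.eL : Expr DiasGen.deg (Fin 2) 0 := .gen dashv
abbrev DiasGen.eR : Expr DiasGen.deg (Fin 2) 0 := .gen vdash

open DiasGen in
/-- `(x ⊢ y) ⊣ z = x ⊢ (y ⊣ z)`, `x ⊣ (y ⊣ z) = x ⊣ (y ⊢ z) = (x ⊣ y) ⊣ z` and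
`(x ⊢ y) ⊢ z = (x ⊣ y) ⊢ z = x ⊢ (y ⊢ z)`. -/
inductive DiasRel : ∀ ⦃I : Type⦄ ⦃k : ℤ⦄, Expr deg I k → Expr deg I k → Prop
  | d_vdash : DiasRel (.d eR) 0
  | d_dashv : DiasRel (.d eL) 0
  | rel₁ : DiasRel (k := 0) (circ₁ eL eR) (circ₂ eR eL)
  | rel₂ : DiasRel (k := 0) (circ₂ eL eL) (circ₂ eL eR)
  | rel₃ : DiasRel (k := 0) (circ₁ eL eL) (circ₂ eL eR)
  | rel₄ : DiasRel (k := 0) (circ₁ eR eR) (circ₁ eR eL)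
  | rel₅ : DiasRel (k := 0) (circ₂ eR eR) (circ₁ eR eL)

/-- The operad of dialgebras. -/
noncomputable def Dias : DGOperad := presented DiasRel
noncomputable def Dias.dashv : Dias.obj (Fin 2) 0 := presented.gen DiasRel .dashv
noncomputable def Dias.vdash : Dias.obj (Fin 2) 0 := presented.gen DiasRel .vdash

/-- Generator `⟨x,y⟩` of `Leib`. -/
inductive LeibGen | angle
def LeibGen.deg : LeibGen → ℤ | angle => 0
abbrev LeibGen.eAngle : Expr LeibGen.deg (Fin 2) 0 := .gen angle

open LeibGen in
/-- `⟨x,⟨y,z⟩⟩ = ⟨⟨x,y⟩,z⟩ - ⟨⟨x,z⟩,y⟩`. -/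
inductive LeibRel : ∀ ⦃I : Type⦄ ⦃k : ℤ⦄, Expr deg I k → Expr deg I k → Prop
  | d_angle : LeibRel (.d eAngle) 0
  | leibniz : LeibRel (k := 0) (circ₂ eAngle eAngle)
      (circ₁ eAngle eAngle - swap₂₃ (circ₁ eAngle eAngle))

/-- The operad of (right) Leibniz algebras. -/
noncomputable def Leib : DGOperad := presented LeibRel
noncomputable def Leib.angle : Leib.obj (Fin 2) 0 := presented.gen LeibRel .angle

/-! ## The diagram -/

/-- A choice of a morphism for each of the twenty-two arrows of the diagram
```
    Zin  <--  Dend  <-- PreLie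
     ^         ^          ^
     Π   <--   K    <--   Λ
     ^         ^          ^
    Com  <--   As   <--  Lie
     ^         ^          ^
    Pasc <--  Trias <--   ⨿
     ^         ^          ^
    Perm <--  Dias  <--  Leib
```
-/
@[ext]
structure Arrows where
  dendZin : Hom Dend Zin
  preLieDend : Hom PreLie Dend
  kPermuto : Hom K Permuto
  lambdaK : Hom Lambda K
  asCom : Hom As Com
  lieAs : Hom Lie As
  triasPasc : Hom Trias Pasc
  amalgTrias : Hom Amalg Trias
  diasPerm : Hom Dias Perm
  leibDias : Hom Leib Dias
  permutoZin : Hom Permuto Zin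
  kDend : Hom K Dend
  lambdaPreLie : Hom Lambda PreLie
  comPermuto : Hom Com Permuto
  asK : Hom As K
  lieLambda : Hom Lie Lambda
  pascCom : Hom Pasc Com
  triasAs : Hom Trias As
  amalgLie : Hom Amalg Lie
  permPasc : Hom Perm Pasc
  diasTrias : Hom Dias Trias
  leibAmalg : Hom Leib Amalg

/-- The morphisms are given on the generators by the prescribed formulas. -/
structure Arrows.Formulas (D : Arrows) : Prop where
  -- horizontal arrows, first row
  dendZin_prec : D.dendZin.app Dend.prec = Zin.prec
  dendZin_succ : D.dendZin.app Dend.succ = Zin.swap Zin.prec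
  preLieDend_graft : D.preLieDend.app PreLie.graft = Dend.prec - Dend.swap Dend.succ
  -- horizontal arrows, second row
  kPermuto_lt : D.kPermuto.app K.lt = Permuto.tens
  kPermuto_gt : D.kPermuto.app K.gt = Permuto.swap Permuto.tens
  kPermuto_bar : D.kPermuto.app K.bar = Permuto.wedge
  lambdaK_graft : D.lambdaK.app Lambda.graft = K.lt - K.swap K.gt
  lambdaK_bracket : D.lambdaK.app Lambda.bracket = K.bar + K.swap K.bar
  -- horizontal arrows, third row
  asCom_mul : D.asCom.app As.mul = Com.mul
  lieAs_bracket : D.lieAs.app Lie.bracket = As.mul - As.swap As.mul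
  -- horizontal arrows, fourth row
  triasPasc_dashv : D.triasPasc.app Trias.dashv = Pasc.e₁
  triasPasc_vdash : D.triasPasc.app Trias.vdash = Pasc.e₂
  triasPasc_cross : D.triasPasc.app Trias.cross = Pasc.wedge
  amalgTrias_angle : D.amalgTrias.app Amalg.angle = Trias.dashv - Trias.swap Trias.vdash
  amalgTrias_bracket : D.amalgTrias.app Amalg.bracket = Trias.cross + Trias.swap Trias.cross
  -- horizontal arrows, fifth row
  diasPerm_dashv : D.diasPerm.app Dias.dashv = Perm.mul
  diasPerm_vdash : D.diasPerm.app Dias.vdash = Perm.swap Perm.mul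
  leibDias_angle : D.leibDias.app Leib.angle = Dias.dashv - Dias.swap Dias.vdash
  -- vertical arrows from the second row to the first one
  permutoZin_tens : D.permutoZin.app Permuto.tens = Zin.prec
  permutoZin_wedge : D.permutoZin.app Permuto.wedge = 0
  kDend_lt : D.kDend.app K.lt = Dend.prec
  kDend_gt : D.kDend.app K.gt = Dend.succ
  kDend_bar : D.kDend.app K.bar = 0
  lambdaPreLie_graft : D.lambdaPreLie.app Lambda.graft = PreLie.graft
  lambdaPreLie_bracket : D.lambdaPreLie.app Lambda.bracket = 0
  -- vertical arrows from the third row to the second one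
  comPermuto_mul : D.comPermuto.app Com.mul = Permuto.tens + Permuto.swap Permuto.tens
  asK_mul : D.asK.app As.mul = K.lt + K.gt
  lieLambda_bracket : D.lieLambda.app Lie.bracket = Lambda.graft - Lambda.swap Lambda.graft
  -- vertical arrows from the fourth row to the third one
  pascCom_e₁ : D.pascCom.app Pasc.e₁ = Com.mul
  pascCom_wedge : D.pascCom.app Pasc.wedge = 0
  triasAs_dashv : D.triasAs.app Trias.dashv = As.mul
  triasAs_vdash : D.triasAs.app Trias.vdash = As.mul
  triasAs_cross : D.triasAs.app Trias.cross = 0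
  amalgLie_angle : D.amalgLie.app Amalg.angle = Lie.bracket
  amalgLie_bracket : D.amalgLie.app Amalg.bracket = 0
  -- vertical arrows from the fifth row to the fourth one
  permPasc_mul : D.permPasc.app Perm.mul = Pasc.e₁
  diasTrias_dashv : D.diasTrias.app Dias.dashv = Trias.dashv
  diasTrias_vdash : D.diasTrias.app Dias.vdash = Trias.vdash
  leibAmalg_angle : D.leibAmalg.app Leib.angle = Amalg.angle

/-- The eight squares of the diagram commute. -/
structure Arrows.Commutes (D : Arrows) : Prop where
  kZin : D.permutoZin.comp D.kPermuto = D.dendZin.comp D.kDend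
  lambdaDend : D.kDend.comp D.lambdaK = D.preLieDend.comp D.lambdaPreLie
  asPermuto : D.comPermuto.comp D.asCom = D.kPermuto.comp D.asK
  lieK : D.asK.comp D.lieAs = D.lambdaK.comp D.lieLambda
  triasCom : D.pascCom.comp D.triasPasc = D.asCom.comp D.triasAs
  amalgAs : D.triasAs.comp D.amalgTrias = D.lieAs.comp D.amalgLie
  diasPasc : D.permPasc.comp D.diasPerm = D.triasPasc.comp D.diasTrias
  leibTrias : D.diasTrias.comp D.leibDias = D.amalgTrias.comp D.leibAmalg

end DGOp

/-!
A morphism out of an operad presented by generators and relations is the same thing as a choice of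
elements of the target, one for each generator, that satisfy the relations (`presented.lift`,
`presented.hom_ext`): the laws that generate the congruence `Cong` hold in every differential graded
operad. For each of the fifteen operads `P` the structure `PRelations Q ..` says that elements of an
arbitrary operad `Q` satisfy the defining relations of `P`, and `PRelations.exists_hom`, `P.hom_ext`
restate the universal property in these terms (they are not needed for `Zin`, which is the source of
no arrow).

An arrow `P → P'` of the diagram therefore amounts to an implication: if some elements of `Q`
satisfy the relations of `P'`, then the prescribed combinations of them satisfy the relations of `P`
(`ZinRelations.dend`, `DendRelations.preLie`, ...). These implications need no information on `P'`
beyond its relations. Each is a linear computation with ternary elements. All of these can be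
written through the elements `x(y(i,j),k)` and `x(i,y(j,k))` (`leftComb`, `rightComb`), on which
permutations act by relabelling; exchanging the inputs of `x` turns one kind into the other, and
exchanging the inputs of `y` permutes two labels. In almost every target the relations of `P'`,
relabelled in all possible ways, can be oriented into rewriting rules after which both sides of a
relation of `P` agree in the free abelian group on what remains.

Uniqueness of the arrows and commutativity of the squares are checked on generators.
-/

namespace DGOp

open DGOp.Expr

/-! ### Morphisms out of a presented operad -/

section UniversalProperty

variable {G : Type} {deg : G → ℤ} {Q : DGOperad}

/-- The value in `Q` of a formal expression, once values have been chosen for the generators. -/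
def Expr.eval (φ : ∀ g, Q.obj (Fin 2) (deg g)) :
    ∀ {I : Type} {k : ℤ}, Expr deg I k → ∀ [Finite I], Q.obj I k
  | _, _, .gen g, _ => φ g
  | _, _, .one, _ => Q.one
  | _, _, @Expr.map _ _ _ _ _ _ _ σ x, _ => Q.map σ (x.eval φ)
  | _, _, @Expr.comp _ _ _ _ _ _ _ _ _ i h x y, _ => Q.comp i h (x.eval φ) (y.eval φ)
  | _, _, .d x, _ => Q.d (x.eval φ)
  | _, _, .zero, _ => 0
  | _, _, .add x y, _ => x.eval φ + y.eval φ
  | _, _, .neg x, _ => -x.eval φ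

theorem Expr.eval_sign (φ : ∀ g, Q.obj (Fin 2) (deg g)) {I : Type} [Finite I] {k : ℤ} (n : ℤ)
    (x : Expr deg I k) : (Expr.sign n x).eval φ = n.negOnePow • x.eval φ := by
  by_cases h : Even n
  · simp [Expr.sign, h, Int.negOnePow_even n h]
  · rw [Int.negOnePow_odd n (Int.not_even_iff_odd.1 h), Units.neg_smul, one_smul]
    simp only [Expr.sign, h, if_false]
    rfl

variable {R : ∀ ⦃I : Type⦄ ⦃k : ℤ⦄, Expr deg I k → Expr deg I k → Prop}

/-- The laws of a differential graded operad hold in `Q`, so evaluation respects the congruence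
as soon as it respects the relations that generate it. -/
theorem Cong.eval_eq {φ : ∀ g, Q.obj (Fin 2) (deg g)}
    (hφ : ∀ {I : Type} [Finite I] {k : ℤ} {x y : Expr deg I k}, R x y → x.eval φ = y.eval φ)
    {I : Type} {k : ℤ} {x y : Expr deg I k} (h : Cong R x y) :
    ∀ [Finite I], x.eval φ = y.eval φ := by
  induction h with
  | of h => exact hφ h
  | refl x => intro _; rfl
  | symm _ ih => exact ih.symm
  | trans _ _ ih₁ ih₂ => exact ih₁.trans ih₂
  | map_congr σ _ ih => exact congrArg (Q.map σ) ih
  | comp_congr i h _ _ ih₁ ih₂ => exact congrArg₂ (fun x y => Q.comp i h x y) ih₁ ih₂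
  | d_congr _ ih => exact congrArg Q.d ih
  | add_congr _ _ ih₁ ih₂ => exact congrArg₂ (· + ·) ih₁ ih₂
  | neg_congr _ ih => exact congrArg (- ·) ih
  | add_assoc x y z => exact _root_.add_assoc _ _ _
  | add_comm x y => exact _root_.add_comm _ _
  | zero_add x => exact _root_.zero_add _
  | neg_add x => exact neg_add_cancel _
  | map_add σ x y => exact _root_.map_add (Q.map σ) _ _
  | d_add x y => exact _root_.map_add Q.d _ _
  | comp_add_left i h x x' y =>
    exact congrArg (· (y.eval φ)) (_root_.map_add (Q.comp i h) (x.eval φ) (x'.eval φ))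
  | comp_add_right i h x y y' => exact _root_.map_add (Q.comp i h (x.eval φ)) _ _
  | d_d x => exact Q.d_d _
  | map_refl x => exact Q.map_refl _
  | map_trans σ τ x => exact Q.map_trans σ τ _
  | d_map σ x => exact Q.d_map σ _
  | d_one => exact Q.d_one
  | d_comp i h h₁ h₂ x y =>
    exact (Q.d_comp i h _ _).trans (congrArg (Q.comp i h₁ (Q.d (x.eval φ)) (y.eval φ) + ·)
      (Expr.eval_sign φ _ (.comp i h₂ x (.d y))).symm)
  | map_comp σ τ hi h x y => exact Q.map_comp σ τ hi h _ _
  | one_comp h y => exact Q.one_comp _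
  | comp_one h i x => exact Q.comp_one i _
  | comp_seq i j h₁ h₂ h₃ h₄ x y z => exact Q.comp_seq i j h₁ h₂ h₃ h₄ _ _ _
  | comp_par hi h₁ h₂ h₃ h₄ x y z =>
    exact (Q.comp_par hi h₁ h₂ h₃ h₄ _ _ _).trans (Expr.eval_sign φ _
      (.comp (.inl ⟨_, hi.symm⟩) h₄ (.comp _ h₃ x z) y)).symm

/-- The morphism out of a presented operad that takes prescribed values on the generators,
provided these values satisfy the relations. -/
noncomputable def presented.lift (φ : ∀ g, Q.obj (Fin 2) (deg g))
    (hφ : ∀ {I : Type} [Finite I] {k : ℤ} {x y : Expr deg I k}, R x y → x.eval φ = y.eval φ) :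
    Hom (presented R) Q where
  app {_ _ _} := AddMonoidHom.mk' (Quotient.lift (fun x => x.eval φ) fun _ _ h => h.eval_eq hφ) (by
    rintro ⟨x⟩ ⟨y⟩
    rfl)
  app_d := by rintro _ _ _ ⟨x⟩; rfl
  app_map := by rintro _ _ _ _ _ σ ⟨x⟩; rfl
  app_one := rfl
  app_comp := by rintro _ _ _ _ _ _ _ i h ⟨x⟩ ⟨y⟩; rfl

/-- A morphism out of a presented operad is determined by its values on the generators. -/
theorem presented.hom_ext {f f' : Hom (presented R) Q}
    (h : ∀ g, f.app (presented.gen R g) = f'.app (presented.gen R g)) : f = f' := by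
  have key : ∀ {I : Type} {k : ℤ} (x : Expr deg I k) [Finite I],
      f.app (show (presented R).obj I k from PObj.mk R x) =
        f'.app (show (presented R).obj I k from PObj.mk R x) := by
    intro I k x
    induction x with
    | gen g => exact h g
    | one => exact f.app_one.trans f'.app_one.symm
    | map σ x ih =>
      exact (f.app_map σ _).trans ((congrArg (Q.map σ) ih).trans (f'.app_map σ _).symm)
    | comp i h x y ih₁ ih₂ =>
      exact (f.app_comp i h _ _).trans
        ((congrArg₂ (fun x y => Q.comp i h x y) ih₁ ih₂).trans (f'.app_comp i h _ _).symm)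
    | d x ih => exact (f.app_d _).trans ((congrArg Q.d ih).trans (f'.app_d _).symm)
    | zero => exact (map_zero f.app).trans (map_zero f'.app).symm
    | add x y ih₁ ih₂ =>
      exact (map_add f.app _ _).trans ((congrArg₂ (· + ·) ih₁ ih₂).trans (map_add f'.app _ _).symm)
    | neg x ih => exact (map_neg f.app _).trans ((congrArg (- ·) ih).trans (map_neg f'.app _).symm)
  ext I _ k x
  obtain ⟨x⟩ := x
  exact key x

end UniversalProperty

/-! ### Ternary elements -/

namespace DGOperad

variable (P : DGOperad) {a b c : ℤ}

/-- `x ∘₁ y = x(y(1,2),3)` for binary elements of an operad. -/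
def circ₁ (x : P.obj (Fin 2) a) (y : P.obj (Fin 2) b) (h : a + b = c := by decide) :
    P.obj (Fin 3) c :=
  P.map circ₁Equiv (P.comp 0 h x y)

/-- `x ∘₂ y = x(1,y(2,3))` for binary elements of an operad. -/
def circ₂ (x : P.obj (Fin 2) a) (y : P.obj (Fin 2) b) (h : a + b = c := by decide) :
    P.obj (Fin 3) c :=
  P.map circ₂Equiv (P.comp 1 h x y)

/-- Action of the cycle `3 → 2 → 1 → 3` on the labels of the inputs. -/
def tau (x : P.obj (Fin 3) c) : P.obj (Fin 3) c := P.map (finRotate 3).symm x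

/-- Exchange of the inputs `2` and `3`. -/
def swap₂₃ (x : P.obj (Fin 3) c) : P.obj (Fin 3) c := P.map (Equiv.swap 1 2) x

open Classical in
/-- The action of the maps `Fin 3 → Fin 3` on ternary elements that extends the action of the
permutations by zero. This makes all relabelling formulas hold without distinctness hypotheses. -/
noncomputable def act (f : Fin 3 → Fin 3) : P.obj (Fin 3) c →+ P.obj (Fin 3) c :=
  if h : f.Bijective then P.map (Equiv.ofBijective f h) else 0

theorem act_equiv (σ : Fin 3 ≃ Fin 3) (x : P.obj (Fin 3) c) : P.act σ x = P.map σ x := by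
  rw [act, dif_pos σ.bijective]
  congr 2
  ext
  rfl

/-- If one of `f`, `g` is not a permutation, then neither is `f ∘ g`, and both sides vanish. -/
theorem act_act (f g : Fin 3 → Fin 3) (x : P.obj (Fin 3) c) :
    P.act f (P.act g x) = P.act (f ∘ g) x := by
  by_cases hg : g.Bijective
  · by_cases hf : f.Bijective
    · simp only [act, dif_pos hg, dif_pos hf, dif_pos (hf.comp hg)]
      rw [← P.map_trans]
      congr 2
      ext
      rfl
    · have : ¬ (f ∘ g).Bijective := fun h =>
        hf (Finite.surjective_iff_bijective.1 h.surjective.of_comp)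
      simp only [act, dif_neg hf, dif_neg this, AddMonoidHom.zero_apply]
  · have : ¬ (f ∘ g).Bijective := fun h =>
      hg (Finite.injective_iff_bijective.1 h.injective.of_comp)
    simp only [act, dif_neg hg, dif_neg this, AddMonoidHom.zero_apply, map_zero]

/-- `x(y(i,j),k)`, understood to be zero unless `i`, `j`, `k` are distinct. -/
noncomputable def leftComb (h : a + b = c) (x : P.obj (Fin 2) a) (y : P.obj (Fin 2) b)
    (i j k : Fin 3) : P.obj (Fin 3) c :=
  P.act ![i, j, k] (P.circ₁ x y h)

/-- `x(i,y(j,k))`, understood to be zero unless `i`, `j`, `k` are distinct. -/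
noncomputable def rightComb (h : a + b = c) (x : P.obj (Fin 2) a) (y : P.obj (Fin 2) b)
    (i j k : Fin 3) : P.obj (Fin 3) c :=
  P.act ![i, j, k] (P.circ₂ x y h)

variable {P} {h : a + b = c} {x x' : P.obj (Fin 2) a} {y y' : P.obj (Fin 2) b} {i j k : Fin 3}

@[simp]
theorem circ₁_eq : P.circ₁ x y h = P.leftComb h x y 0 1 2 := by
  have : (![0, 1, 2] : Fin 3 → Fin 3) = Equiv.refl _ := by decide
  rw [leftComb, this, act_equiv, P.map_refl]

@[simp]
theorem circ₂_eq : P.circ₂ x y h = P.rightComb h x y 0 1 2 := by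
  have : (![0, 1, 2] : Fin 3 → Fin 3) = Equiv.refl _ := by decide
  rw [rightComb, this, act_equiv, P.map_refl]

@[simp]
theorem act_leftComb (f : Fin 3 → Fin 3) :
    P.act f (P.leftComb h x y i j k) = P.leftComb h x y (f i) (f j) (f k) := by
  rw [leftComb, act_act, leftComb]
  congr 2
  ext l
  fin_cases l <;> rfl

@[simp]
theorem act_rightComb (f : Fin 3 → Fin 3) :
    P.act f (P.rightComb h x y i j k) = P.rightComb h x y (f i) (f j) (f k) := by
  rw [rightComb, act_act, rightComb]
  congr 2
  ext l
  fin_cases l <;> rfl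

@[simp]
theorem tau_eq (z : P.obj (Fin 3) c) : P.tau z = P.act ![2, 0, 1] z := by
  have : (![2, 0, 1] : Fin 3 → Fin 3) = (finRotate 3).symm := by decide
  rw [this, act_equiv, tau]

@[simp]
theorem swap₂₃_eq (z : P.obj (Fin 3) c) : P.swap₂₃ z = P.act ![0, 2, 1] z := by
  have : (![0, 2, 1] : Fin 3 → Fin 3) = Equiv.swap 1 2 := by decide
  rw [this, act_equiv, swap₂₃]

@[simp]
theorem swap_swap (x : P.obj (Fin 2) a) : P.swap (P.swap x) = x := by
  have : (Equiv.swap (0 : Fin 2) 1).trans (Equiv.swap 0 1) = Equiv.refl _ := by decide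
  rw [swap, swap, ← P.map_trans, this, P.map_refl]

/-- Exchanging the inputs of the root. -/
@[simp]
theorem leftComb_swap_left : P.leftComb h (P.swap x) y i j k = P.rightComb h x y k i j := by
  have : P.circ₁ (P.swap x) y h = P.act ![2, 0, 1] (P.circ₂ x y h) := by
    have e : (![2, 0, 1] : Fin 3 → Fin 3) = (finRotate 3).symm := by decide
    rw [e, act_equiv]
    unfold circ₁ circ₂ swap
    conv_lhs => rw [← P.map_refl y,
      ← P.map_comp (Equiv.swap 0 1) (Equiv.refl _) (i := 1) (i' := 0) (by decide),
      ← P.map_trans]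
    rw [← P.map_trans]
    congr 2
    ext l
    revert l
    decide
  rw [leftComb, this, act_act, rightComb]
  congr 2
  ext l
  fin_cases l <;> rfl

@[simp]
theorem rightComb_swap_left : P.rightComb h (P.swap x) y i j k = P.leftComb h x y j k i := by
  rw [← leftComb_swap_left, swap_swap]

/-- Exchanging the inputs of the upper vertex. -/
@[simp]
theorem leftComb_swap_right : P.leftComb h x (P.swap y) i j k = P.leftComb h x y j i k := by
  have : P.circ₁ x (P.swap y) h = P.act ![1, 0, 2] (P.circ₁ x y h) := by
    have e : (![1, 0, 2] : Fin 3 → Fin 3) = Equiv.swap 0 1 := by decide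
    rw [e, act_equiv]
    unfold circ₁ swap
    conv_lhs => rw [← P.map_refl x,
      ← P.map_comp (Equiv.refl _) (Equiv.swap 0 1) (i := 0) (i' := 0) (by decide),
      ← P.map_trans]
    rw [← P.map_trans]
    congr 2
    ext l
    revert l
    decide
  rw [leftComb, this, act_act, leftComb]
  congr 2
  ext l
  fin_cases l <;> rfl

@[simp]
theorem rightComb_swap_right : P.rightComb h x (P.swap y) i j k = P.rightComb h x y i k j := by
  rw [← leftComb_swap_left, leftComb_swap_right, leftComb_swap_left]

@[simp] theorem leftComb_add_left : P.leftComb h (x + x') y i j k =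
    P.leftComb h x y i j k + P.leftComb h x' y i j k := by simp [leftComb, circ₁, -circ₁_eq]
@[simp] theorem leftComb_add_right : P.leftComb h x (y + y') i j k =
    P.leftComb h x y i j k + P.leftComb h x y' i j k := by simp [leftComb, circ₁, -circ₁_eq]
@[simp] theorem leftComb_sub_left : P.leftComb h (x - x') y i j k =
    P.leftComb h x y i j k - P.leftComb h x' y i j k := by simp [leftComb, circ₁, -circ₁_eq]
@[simp] theorem leftComb_sub_right : P.leftComb h x (y - y') i j k =
    P.leftComb h x y i j k - P.leftComb h x y' i j k := by simp [leftComb, circ₁, -circ₁_eq]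
@[simp] theorem leftComb_neg_left : P.leftComb h (-x) y i j k = -P.leftComb h x y i j k := by
  simp [leftComb, circ₁, -circ₁_eq]
@[simp] theorem leftComb_neg_right : P.leftComb h x (-y) i j k = -P.leftComb h x y i j k := by
  simp [leftComb, circ₁, -circ₁_eq]
@[simp] theorem leftComb_zero_left : P.leftComb h 0 y i j k = 0 := by
  simp [leftComb, circ₁, -circ₁_eq]
@[simp] theorem leftComb_zero_right : P.leftComb h x 0 i j k = 0 := by
  simp [leftComb, circ₁, -circ₁_eq]
@[simp] theorem rightComb_add_left : P.rightComb h (x + x') y i j k =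
    P.rightComb h x y i j k + P.rightComb h x' y i j k := by simp [rightComb, circ₂, -circ₂_eq]
@[simp] theorem rightComb_add_right : P.rightComb h x (y + y') i j k =
    P.rightComb h x y i j k + P.rightComb h x y' i j k := by simp [rightComb, circ₂, -circ₂_eq]
@[simp] theorem rightComb_sub_left : P.rightComb h (x - x') y i j k =
    P.rightComb h x y i j k - P.rightComb h x' y i j k := by simp [rightComb, circ₂, -circ₂_eq]
@[simp] theorem rightComb_sub_right : P.rightComb h x (y - y') i j k =
    P.rightComb h x y i j k - P.rightComb h x y' i j k := by simp [rightComb, circ₂, -circ₂_eq]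
@[simp] theorem rightComb_zero_left : P.rightComb h 0 y i j k = 0 := by
  simp [rightComb, circ₂, -circ₂_eq]
@[simp] theorem rightComb_zero_right : P.rightComb h x 0 i j k = 0 := by
  simp [rightComb, circ₂, -circ₂_eq]

@[simp] theorem swap_add (x y : P.obj (Fin 2) a) : P.swap (x + y) = P.swap x + P.swap y :=
  map_add _ _ _
@[simp] theorem swap_sub (x y : P.obj (Fin 2) a) : P.swap (x - y) = P.swap x - P.swap y :=
  map_sub _ _ _
@[simp] theorem swap_neg (x : P.obj (Fin 2) a) : P.swap (-x) = -P.swap x := map_neg _ _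
@[simp] theorem swap_zero : P.swap (0 : P.obj (Fin 2) a) = 0 := map_zero _
@[simp] theorem d_swap (x : P.obj (Fin 2) a) : P.d (P.swap x) = P.swap (P.d x) := P.d_map _ _

end DGOperad

/-! ### The universal properties of the fifteen operads -/

/-- The defining relations of `Zin`, for elements of an arbitrary operad. Here and below, the degree
of a composite is fixed by a type ascription. -/
structure ZinRelations (Q : DGOperad) (p : Q.obj (Fin 2) 0) : Prop where
  d_prec : Q.d p = 0
  zinbiel : (Q.circ₁ p p : Q.obj (Fin 3) 0) = Q.circ₂ p p + Q.circ₂ p (Q.swap p)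

theorem Zin.relations : ZinRelations Zin Zin.prec where
  d_prec := Quotient.sound (.of .d_prec)
  zinbiel := Quotient.sound (.of .zinbiel)

/-- The defining relations of `Dend`, for elements of an arbitrary operad. -/
structure DendRelations (Q : DGOperad) (p s : Q.obj (Fin 2) 0) : Prop where
  d_prec : Q.d p = 0
  d_succ : Q.d s = 0
  dend₁ : (Q.circ₂ s p : Q.obj (Fin 3) 0) = Q.circ₁ p s
  dend₂ : (Q.circ₂ s s : Q.obj (Fin 3) 0) = Q.circ₁ s s + Q.circ₁ s p
  dend₃ : (Q.circ₁ p p : Q.obj (Fin 3) 0) = Q.circ₂ p p + Q.circ₂ p s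

theorem Dend.relations : DendRelations Dend Dend.prec Dend.succ where
  d_prec := Quotient.sound (.of .d_prec)
  d_succ := Quotient.sound (.of .d_succ)
  dend₁ := Quotient.sound (.of .dend₁)
  dend₂ := Quotient.sound (.of .dend₂)
  dend₃ := Quotient.sound (.of .dend₃)

theorem DendRelations.exists_hom {Q : DGOperad} {p s : Q.obj (Fin 2) 0}
    (h : DendRelations Q p s) :
    ∃ f : Hom Dend Q, f.app Dend.prec = p ∧ f.app Dend.succ = s := by
  refine ⟨presented.lift (fun i => match i with
    | .prec => p
    | .succ => s) ?_, rfl, rfl⟩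
  rintro I _ k x y ⟨⟩
  · exact h.d_prec
  · exact h.d_succ
  · exact h.dend₁
  · exact h.dend₂
  · exact h.dend₃

theorem Dend.hom_ext {Q : DGOperad} {f f' : Hom Dend Q}
    (h₁ : f.app Dend.prec = f'.app Dend.prec)
    (h₂ : f.app Dend.succ = f'.app Dend.succ) : f = f' :=
  presented.hom_ext fun i => match i with
  | .prec => h₁
  | .succ => h₂

/-- The defining relations of `PreLie`, for elements of an arbitrary operad. -/
structure PreLieRelations (Q : DGOperad) (a : Q.obj (Fin 2) 0) : Prop where
  d_graft : Q.d a = 0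
  preLie : (Q.circ₁ a a - Q.circ₂ a a : Q.obj (Fin 3) 0) = Q.swap₂₃ (Q.circ₁ a a - Q.circ₂ a a)

theorem PreLie.relations : PreLieRelations PreLie PreLie.graft where
  d_graft := Quotient.sound (.of .d_graft)
  preLie := Quotient.sound (.of .preLie)

theorem PreLieRelations.exists_hom {Q : DGOperad} {a : Q.obj (Fin 2) 0}
    (h : PreLieRelations Q a) :
    ∃ f : Hom PreLie Q, f.app PreLie.graft = a := by
  refine ⟨presented.lift (fun i => match i with
    | .graft => a) ?_, rfl⟩
  rintro I _ k x y ⟨⟩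
  · exact h.d_graft
  -- Subtraction of expressions is defined as `x + -y`, and evaluated as such.
  · have h' := h.preLie
    simp only [sub_eq_add_neg] at h'
    exact h'

theorem PreLie.hom_ext {Q : DGOperad} {f f' : Hom PreLie Q}
    (h : f.app PreLie.graft = f'.app PreLie.graft) : f = f' :=
  presented.hom_ext fun i => match i with
  | .graft => h

/-- The defining relations of `Permuto`, for elements of an arbitrary operad. -/
structure PermutoRelations (Q : DGOperad) (t : Q.obj (Fin 2) 0) (w : Q.obj (Fin 2) 1) : Prop where
  wedge_antisymm : Q.swap w = -w
  d_tens : (Q.d t : Q.obj (Fin 2) 1) = w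
  d_wedge : Q.d w = 0
  rel₁ : (Q.circ₁ t t : Q.obj (Fin 3) 0) = Q.circ₂ t t + Q.circ₂ t (Q.swap t)
  rel₂ : (Q.circ₂ w t : Q.obj (Fin 3) 1) = Q.circ₁ t w
  rel₂' : (Q.circ₁ t w : Q.obj (Fin 3) 1) = Q.tau (Q.circ₁ w (Q.swap t))
  rel₃ : (Q.circ₁ (Q.swap w) w : Q.obj (Fin 3) 2) = Q.circ₂ w w

theorem Permuto.relations : PermutoRelations Permuto Permuto.tens Permuto.wedge where
  wedge_antisymm := Quotient.sound (.of .wedge_antisymm)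
  d_tens := Quotient.sound (.of .d_tens)
  d_wedge := Quotient.sound (.of .d_wedge)
  rel₁ := Quotient.sound (.of .rel₁)
  rel₂ := Quotient.sound (.of .rel₂)
  rel₂' := Quotient.sound (.of .rel₂')
  rel₃ := Quotient.sound (.of .rel₃)

theorem PermutoRelations.exists_hom {Q : DGOperad} {t : Q.obj (Fin 2) 0} {w : Q.obj (Fin 2) 1}
    (h : PermutoRelations Q t w) :
    ∃ f : Hom Permuto Q, f.app Permuto.tens = t ∧ f.app Permuto.wedge = w := by
  refine ⟨presented.lift (fun i => match i with
    | .tens => t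
    | .wedge => w) ?_, rfl, rfl⟩
  rintro I _ k x y ⟨⟩
  · exact h.wedge_antisymm
  · exact h.d_tens
  · exact h.d_wedge
  · exact h.rel₁
  · exact h.rel₂
  · exact h.rel₂'
  · exact h.rel₃

theorem Permuto.hom_ext {Q : DGOperad} {f f' : Hom Permuto Q}
    (h₁ : f.app Permuto.tens = f'.app Permuto.tens)
    (h₂ : f.app Permuto.wedge = f'.app Permuto.wedge) : f = f' :=
  presented.hom_ext fun i => match i with
  | .tens => h₁
  | .wedge => h₂

/-- The defining relations of `K`, for elements of an arbitrary operad. -/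
structure KRelations (Q : DGOperad) (l g : Q.obj (Fin 2) 0) (b : Q.obj (Fin 2) 1) : Prop where
  d_lt : (Q.d l : Q.obj (Fin 2) 1) = b
  d_gt : (Q.d g : Q.obj (Fin 2) 1) = -b
  d_bar : Q.d b = 0
  rel₁ : (Q.circ₂ g l : Q.obj (Fin 3) 0) = Q.circ₁ l g
  rel₂ : (Q.circ₂ g g : Q.obj (Fin 3) 0) = Q.circ₁ g g + Q.circ₁ g l
  rel₃ : (Q.circ₁ l l : Q.obj (Fin 3) 0) = Q.circ₂ l l + Q.circ₂ l g
  rel₄ : (Q.circ₂ g b : Q.obj (Fin 3) 1) = Q.circ₁ b g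
  rel₅ : (Q.circ₁ l b : Q.obj (Fin 3) 1) = Q.circ₂ b l
  rel₆ : (Q.circ₁ b l : Q.obj (Fin 3) 1) = Q.circ₂ b g
  rel₇ : (Q.circ₁ b b : Q.obj (Fin 3) 2) = -Q.circ₂ b b

theorem K.relations : KRelations K K.lt K.gt K.bar where
  d_lt := Quotient.sound (.of .d_lt)
  d_gt := Quotient.sound (.of .d_gt)
  d_bar := Quotient.sound (.of .d_bar)
  rel₁ := Quotient.sound (.of .rel₁)
  rel₂ := Quotient.sound (.of .rel₂)
  rel₃ := Quotient.sound (.of .rel₃)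
  rel₄ := Quotient.sound (.of .rel₄)
  rel₅ := Quotient.sound (.of .rel₅)
  rel₆ := Quotient.sound (.of .rel₆)
  rel₇ := Quotient.sound (.of .rel₇)

theorem KRelations.exists_hom {Q : DGOperad} {l g : Q.obj (Fin 2) 0} {b : Q.obj (Fin 2) 1}
    (h : KRelations Q l g b) :
    ∃ f : Hom K Q, f.app K.lt = l ∧ f.app K.gt = g ∧ f.app K.bar = b := by
  refine ⟨presented.lift (fun i => match i with
    | .lt => l
    | .gt => g
    | .bar => b) ?_, rfl, rfl, rfl⟩
  rintro I _ k x y ⟨⟩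
  · exact h.d_lt
  · exact h.d_gt
  · exact h.d_bar
  · exact h.rel₁
  · exact h.rel₂
  · exact h.rel₃
  · exact h.rel₄
  · exact h.rel₅
  · exact h.rel₆
  · exact h.rel₇

theorem K.hom_ext {Q : DGOperad} {f f' : Hom K Q}
    (h₁ : f.app K.lt = f'.app K.lt)
    (h₂ : f.app K.gt = f'.app K.gt)
    (h₃ : f.app K.bar = f'.app K.bar) : f = f' :=
  presented.hom_ext fun i => match i with
  | .lt => h₁
  | .gt => h₂
  | .bar => h₃

/-- The defining relations of `Lambda`, for elements of an arbitrary operad. -/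
structure LambdaRelations (Q : DGOperad) (a : Q.obj (Fin 2) 0) (c : Q.obj (Fin 2) 1) : Prop where
  bracket_symm : Q.swap c = c
  d_graft : (Q.d a : Q.obj (Fin 2) 1) = c
  d_bracket : Q.d c = 0
  preLie : (Q.circ₁ a a - Q.circ₂ a a : Q.obj (Fin 3) 0) = Q.swap₂₃ (Q.circ₁ a a - Q.circ₂ a a)
  deriv : (Q.circ₁ a c : Q.obj (Fin 3) 1) = Q.swap₂₃ (Q.circ₁ c a) + Q.circ₂ c a
  jacobi : (Q.circ₁ c c + Q.tau (Q.circ₁ c c) + Q.tau (Q.tau (Q.circ₁ c c)) : Q.obj (Fin 3) 2) = 0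

theorem Lambda.relations : LambdaRelations Lambda Lambda.graft Lambda.bracket where
  bracket_symm := Quotient.sound (.of .bracket_symm)
  d_graft := Quotient.sound (.of .d_graft)
  d_bracket := Quotient.sound (.of .d_bracket)
  preLie := Quotient.sound (.of .preLie)
  deriv := Quotient.sound (.of .deriv)
  jacobi := Quotient.sound (.of .jacobi)

theorem LambdaRelations.exists_hom {Q : DGOperad} {a : Q.obj (Fin 2) 0} {c : Q.obj (Fin 2) 1}
    (h : LambdaRelations Q a c) :
    ∃ f : Hom Lambda Q, f.app Lambda.graft = a ∧ f.app Lambda.bracket = c := by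
  refine ⟨presented.lift (fun i => match i with
    | .graft => a
    | .bracket => c) ?_, rfl, rfl⟩
  rintro I _ k x y ⟨⟩
  · exact h.bracket_symm
  · exact h.d_graft
  · exact h.d_bracket
  · have h' := h.preLie
    simp only [sub_eq_add_neg] at h'
    exact h'
  · exact h.deriv
  · exact h.jacobi

theorem Lambda.hom_ext {Q : DGOperad} {f f' : Hom Lambda Q}
    (h₁ : f.app Lambda.graft = f'.app Lambda.graft)
    (h₂ : f.app Lambda.bracket = f'.app Lambda.bracket) : f = f' :=
  presented.hom_ext fun i => match i with
  | .graft => h₁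
  | .bracket => h₂

/-- The defining relations of `Com`, for elements of an arbitrary operad. -/
structure ComRelations (Q : DGOperad) (m : Q.obj (Fin 2) 0) : Prop where
  mul_symm : Q.swap m = m
  d_mul : Q.d m = 0
  assoc : (Q.circ₁ m m : Q.obj (Fin 3) 0) = Q.circ₂ m m

theorem Com.relations : ComRelations Com Com.mul where
  mul_symm := Quotient.sound (.of .mul_symm)
  d_mul := Quotient.sound (.of .d_mul)
  assoc := Quotient.sound (.of .assoc)

theorem ComRelations.exists_hom {Q : DGOperad} {m : Q.obj (Fin 2) 0}
    (h : ComRelations Q m) :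
    ∃ f : Hom Com Q, f.app Com.mul = m := by
  refine ⟨presented.lift (fun i => match i with
    | .mul => m) ?_, rfl⟩
  rintro I _ k x y ⟨⟩
  · exact h.mul_symm
  · exact h.d_mul
  · exact h.assoc

theorem Com.hom_ext {Q : DGOperad} {f f' : Hom Com Q}
    (h : f.app Com.mul = f'.app Com.mul) : f = f' :=
  presented.hom_ext fun i => match i with
  | .mul => h

/-- The defining relations of `As`, for elements of an arbitrary operad. -/
structure AsRelations (Q : DGOperad) (m : Q.obj (Fin 2) 0) : Prop where
  d_mul : Q.d m = 0
  assoc : (Q.circ₁ m m : Q.obj (Fin 3) 0) = Q.circ₂ m m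

theorem As.relations : AsRelations As As.mul where
  d_mul := Quotient.sound (.of .d_mul)
  assoc := Quotient.sound (.of .assoc)

theorem AsRelations.exists_hom {Q : DGOperad} {m : Q.obj (Fin 2) 0}
    (h : AsRelations Q m) :
    ∃ f : Hom As Q, f.app As.mul = m := by
  refine ⟨presented.lift (fun i => match i with
    | .mul => m) ?_, rfl⟩
  rintro I _ k x y ⟨⟩
  · exact h.d_mul
  · exact h.assoc

theorem As.hom_ext {Q : DGOperad} {f f' : Hom As Q}
    (h : f.app As.mul = f'.app As.mul) : f = f' :=
  presented.hom_ext fun i => match i with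
  | .mul => h

/-- The defining relations of `Lie`, for elements of an arbitrary operad. -/
structure LieRelations (Q : DGOperad) (c : Q.obj (Fin 2) 0) : Prop where
  bracket_antisymm : Q.swap c = -c
  d_bracket : Q.d c = 0
  jacobi : (Q.circ₁ c c + Q.tau (Q.circ₁ c c) + Q.tau (Q.tau (Q.circ₁ c c)) : Q.obj (Fin 3) 0) = 0

theorem Lie.relations : LieRelations Lie Lie.bracket where
  bracket_antisymm := Quotient.sound (.of .bracket_antisymm)
  d_bracket := Quotient.sound (.of .d_bracket)
  jacobi := Quotient.sound (.of .jacobi)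

theorem LieRelations.exists_hom {Q : DGOperad} {c : Q.obj (Fin 2) 0}
    (h : LieRelations Q c) :
    ∃ f : Hom Lie Q, f.app Lie.bracket = c := by
  refine ⟨presented.lift (fun i => match i with
    | .bracket => c) ?_, rfl⟩
  rintro I _ k x y ⟨⟩
  · exact h.bracket_antisymm
  · exact h.d_bracket
  · exact h.jacobi

theorem Lie.hom_ext {Q : DGOperad} {f f' : Hom Lie Q}
    (h : f.app Lie.bracket = f'.app Lie.bracket) : f = f' :=
  presented.hom_ext fun i => match i with
  | .bracket => h

/-- The defining relations of `Pasc`, for elements of an arbitrary operad. -/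
structure PascRelations (Q : DGOperad) (e : Q.obj (Fin 2) 0) (w : Q.obj (Fin 2) (-1)) : Prop where
  wedge_antisymm : Q.swap w = -w
  d_wedge : (Q.d w : Q.obj (Fin 2) 0) = e - Q.swap e
  d_e : Q.d e = 0
  rel₁ : (Q.circ₁ e e : Q.obj (Fin 3) 0) = Q.tau (Q.tau (Q.circ₁ (Q.swap e) e))
  rel₂ : (Q.circ₁ (Q.swap e) e : Q.obj (Fin 3) 0) = Q.circ₁ (Q.swap e) (Q.swap e)
  rel₃ : (Q.circ₁ e (Q.swap e) : Q.obj (Fin 3) 0) = Q.tau (Q.circ₁ (Q.swap e) (Q.swap e))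
  rel₄ : (Q.circ₁ (Q.swap e) w : Q.obj (Fin 3) (-1)) = 0
  rel₅ : (Q.tau (Q.circ₁ w (Q.swap e)) : Q.obj (Fin 3) (-1)) = Q.circ₁ e w
  rel₆ : (-Q.tau (Q.tau (Q.circ₁ w e)) : Q.obj (Fin 3) (-1)) = Q.circ₁ e w
  rel₇ : (Q.circ₁ w w : Q.obj (Fin 3) (-2)) = Q.tau (Q.circ₁ w w)

theorem Pasc.relations : PascRelations Pasc Pasc.e₁ Pasc.wedge where
  wedge_antisymm := Quotient.sound (.of .wedge_antisymm)
  d_wedge := Quotient.sound (.of .d_wedge)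
  d_e := Quotient.sound (.of .d_e)
  rel₁ := Quotient.sound (.of .rel₁)
  rel₂ := Quotient.sound (.of .rel₂)
  rel₃ := Quotient.sound (.of .rel₃)
  rel₄ := Quotient.sound (.of .rel₄)
  rel₅ := Quotient.sound (.of .rel₅)
  rel₆ := Quotient.sound (.of .rel₆)
  rel₇ := Quotient.sound (.of .rel₇)

theorem PascRelations.exists_hom {Q : DGOperad} {e : Q.obj (Fin 2) 0} {w : Q.obj (Fin 2) (-1)}
    (h : PascRelations Q e w) :
    ∃ f : Hom Pasc Q, f.app Pasc.e₁ = e ∧ f.app Pasc.wedge = w := by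
  refine ⟨presented.lift (fun i => match i with
    | .e => e
    | .wedge => w) ?_, rfl, rfl⟩
  rintro I _ k x y ⟨⟩
  · exact h.wedge_antisymm
  · have h' := h.d_wedge
    simp only [sub_eq_add_neg] at h'
    exact h'
  · exact h.d_e
  · exact h.rel₁
  · exact h.rel₂
  · exact h.rel₃
  · exact h.rel₄
  · exact h.rel₅
  · exact h.rel₆
  · exact h.rel₇

theorem Pasc.hom_ext {Q : DGOperad} {f f' : Hom Pasc Q}
    (h₁ : f.app Pasc.e₁ = f'.app Pasc.e₁)
    (h₂ : f.app Pasc.wedge = f'.app Pasc.wedge) : f = f' :=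
  presented.hom_ext fun i => match i with
  | .e => h₁
  | .wedge => h₂

/-- The defining relations of `Trias`, for elements of an arbitrary operad. -/
structure TriasRelations (Q : DGOperad) (l r : Q.obj (Fin 2) 0)
    (x : Q.obj (Fin 2) (-1)) : Prop where
  d_cross : (Q.d x : Q.obj (Fin 2) 0) = l - r
  d_vdash : Q.d r = 0
  d_dashv : Q.d l = 0
  rel₁ : (Q.circ₁ l r : Q.obj (Fin 3) 0) = Q.circ₂ r l
  rel₂ : (Q.circ₂ l l : Q.obj (Fin 3) 0) = Q.circ₂ l r
  rel₃ : (Q.circ₁ l l : Q.obj (Fin 3) 0) = Q.circ₂ l r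
  rel₄ : (Q.circ₁ r r : Q.obj (Fin 3) 0) = Q.circ₁ r l
  rel₅ : (Q.circ₂ r r : Q.obj (Fin 3) 0) = Q.circ₁ r l
  rel₆ : (Q.circ₁ x r : Q.obj (Fin 3) (-1)) = Q.circ₂ r x
  rel₇ : (Q.circ₂ x l : Q.obj (Fin 3) (-1)) = Q.circ₁ l x
  rel₈ : (Q.circ₁ x l : Q.obj (Fin 3) (-1)) = Q.circ₂ x r
  rel₉ : (Q.circ₁ r x : Q.obj (Fin 3) (-1)) = 0
  rel₁₀ : (Q.circ₂ l x : Q.obj (Fin 3) (-1)) = 0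
  rel₁₁ : (Q.circ₁ x x : Q.obj (Fin 3) (-2)) = -Q.circ₂ x x

theorem Trias.relations : TriasRelations Trias Trias.dashv Trias.vdash Trias.cross where
  d_cross := Quotient.sound (.of .d_cross)
  d_vdash := Quotient.sound (.of .d_vdash)
  d_dashv := Quotient.sound (.of .d_dashv)
  rel₁ := Quotient.sound (.of .rel₁)
  rel₂ := Quotient.sound (.of .rel₂)
  rel₃ := Quotient.sound (.of .rel₃)
  rel₄ := Quotient.sound (.of .rel₄)
  rel₅ := Quotient.sound (.of .rel₅)
  rel₆ := Quotient.sound (.of .rel₆)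
  rel₇ := Quotient.sound (.of .rel₇)
  rel₈ := Quotient.sound (.of .rel₈)
  rel₉ := Quotient.sound (.of .rel₉)
  rel₁₀ := Quotient.sound (.of .rel₁₀)
  rel₁₁ := Quotient.sound (.of .rel₁₁)

theorem TriasRelations.exists_hom {Q : DGOperad} {l r : Q.obj (Fin 2) 0} {x : Q.obj (Fin 2) (-1)}
    (h : TriasRelations Q l r x) :
    ∃ f : Hom Trias Q, f.app Trias.dashv = l ∧ f.app Trias.vdash = r ∧ f.app Trias.cross = x := by
  refine ⟨presented.lift (fun i => match i with
    | .dashv => l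
    | .vdash => r
    | .cross => x) ?_, rfl, rfl, rfl⟩
  rintro I _ k x y ⟨⟩
  · have h' := h.d_cross
    simp only [sub_eq_add_neg] at h'
    exact h'
  · exact h.d_vdash
  · exact h.d_dashv
  · exact h.rel₁
  · exact h.rel₂
  · exact h.rel₃
  · exact h.rel₄
  · exact h.rel₅
  · exact h.rel₆
  · exact h.rel₇
  · exact h.rel₈
  · exact h.rel₉
  · exact h.rel₁₀
  · exact h.rel₁₁

theorem Trias.hom_ext {Q : DGOperad} {f f' : Hom Trias Q}
    (h₁ : f.app Trias.dashv = f'.app Trias.dashv)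
    (h₂ : f.app Trias.vdash = f'.app Trias.vdash)
    (h₃ : f.app Trias.cross = f'.app Trias.cross) : f = f' :=
  presented.hom_ext fun i => match i with
  | .dashv => h₁
  | .vdash => h₂
  | .cross => h₃

/-- The defining relations of `Amalg`, for elements of an arbitrary operad. -/
structure AmalgRelations (Q : DGOperad) (u : Q.obj (Fin 2) 0) (c : Q.obj (Fin 2) (-1)) : Prop where
  bracket_symm : Q.swap c = c
  d_bracket : (Q.d c : Q.obj (Fin 2) 0) = u + Q.swap u
  d_angle : Q.d u = 0
  rel₁ : (Q.circ₁ u u - Q.tau (Q.circ₁ u (Q.swap u)) +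
      Q.tau (Q.tau (Q.circ₁ (Q.swap u) (Q.swap u))) : Q.obj (Fin 3) 0) = 0
  rel₂ : (Q.tau (Q.tau (Q.circ₁ c u)) + Q.tau (Q.circ₁ c (Q.swap u)) : Q.obj (Fin 3) (-1)) =
      Q.circ₁ u c
  rel₃ : (Q.circ₁ (Q.swap u) c : Q.obj (Fin 3) (-1)) = 0
  rel₄ : (Q.circ₁ c c + Q.tau (Q.circ₁ c c) + Q.tau (Q.tau (Q.circ₁ c c)) : Q.obj (Fin 3) (-2)) = 0

theorem Amalg.relations : AmalgRelations Amalg Amalg.angle Amalg.bracket where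
  bracket_symm := Quotient.sound (.of .bracket_symm)
  d_bracket := Quotient.sound (.of .d_bracket)
  d_angle := Quotient.sound (.of .d_angle)
  rel₁ := Quotient.sound (.of .rel₁)
  rel₂ := Quotient.sound (.of .rel₂)
  rel₃ := Quotient.sound (.of .rel₃)
  rel₄ := Quotient.sound (.of .rel₄)

theorem AmalgRelations.exists_hom {Q : DGOperad} {u : Q.obj (Fin 2) 0} {c : Q.obj (Fin 2) (-1)}
    (h : AmalgRelations Q u c) :
    ∃ f : Hom Amalg Q, f.app Amalg.angle = u ∧ f.app Amalg.bracket = c := by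
  refine ⟨presented.lift (fun i => match i with
    | .angle => u
    | .bracket => c) ?_, rfl, rfl⟩
  rintro I _ k x y ⟨⟩
  · exact h.bracket_symm
  · exact h.d_bracket
  · exact h.d_angle
  · have h' := h.rel₁
    simp only [sub_eq_add_neg] at h'
    exact h'
  · exact h.rel₂
  · exact h.rel₃
  · exact h.rel₄

theorem Amalg.hom_ext {Q : DGOperad} {f f' : Hom Amalg Q}
    (h₁ : f.app Amalg.angle = f'.app Amalg.angle)
    (h₂ : f.app Amalg.bracket = f'.app Amalg.bracket) : f = f' :=
  presented.hom_ext fun i => match i with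
  | .angle => h₁
  | .bracket => h₂

/-- The defining relations of `Perm`, for elements of an arbitrary operad. -/
structure PermRelations (Q : DGOperad) (m : Q.obj (Fin 2) 0) : Prop where
  d_mul : Q.d m = 0
  assoc : (Q.circ₁ m m : Q.obj (Fin 3) 0) = Q.circ₂ m m
  perm : (Q.circ₂ m m : Q.obj (Fin 3) 0) = Q.circ₂ m (Q.swap m)

theorem Perm.relations : PermRelations Perm Perm.mul where
  d_mul := Quotient.sound (.of .d_mul)
  assoc := Quotient.sound (.of .assoc)
  perm := Quotient.sound (.of .perm)

theorem PermRelations.exists_hom {Q : DGOperad} {m : Q.obj (Fin 2) 0}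
    (h : PermRelations Q m) :
    ∃ f : Hom Perm Q, f.app Perm.mul = m := by
  refine ⟨presented.lift (fun i => match i with
    | .mul => m) ?_, rfl⟩
  rintro I _ k x y ⟨⟩
  · exact h.d_mul
  · exact h.assoc
  · exact h.perm

theorem Perm.hom_ext {Q : DGOperad} {f f' : Hom Perm Q}
    (h : f.app Perm.mul = f'.app Perm.mul) : f = f' :=
  presented.hom_ext fun i => match i with
  | .mul => h

/-- The defining relations of `Dias`, for elements of an arbitrary operad. -/
structure DiasRelations (Q : DGOperad) (l r : Q.obj (Fin 2) 0) : Prop where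
  d_vdash : Q.d r = 0
  d_dashv : Q.d l = 0
  rel₁ : (Q.circ₁ l r : Q.obj (Fin 3) 0) = Q.circ₂ r l
  rel₂ : (Q.circ₂ l l : Q.obj (Fin 3) 0) = Q.circ₂ l r
  rel₃ : (Q.circ₁ l l : Q.obj (Fin 3) 0) = Q.circ₂ l r
  rel₄ : (Q.circ₁ r r : Q.obj (Fin 3) 0) = Q.circ₁ r l
  rel₅ : (Q.circ₂ r r : Q.obj (Fin 3) 0) = Q.circ₁ r l

theorem Dias.relations : DiasRelations Dias Dias.dashv Dias.vdash where
  d_vdash := Quotient.sound (.of .d_vdash)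
  d_dashv := Quotient.sound (.of .d_dashv)
  rel₁ := Quotient.sound (.of .rel₁)
  rel₂ := Quotient.sound (.of .rel₂)
  rel₃ := Quotient.sound (.of .rel₃)
  rel₄ := Quotient.sound (.of .rel₄)
  rel₅ := Quotient.sound (.of .rel₅)

theorem DiasRelations.exists_hom {Q : DGOperad} {l r : Q.obj (Fin 2) 0}
    (h : DiasRelations Q l r) :
    ∃ f : Hom Dias Q, f.app Dias.dashv = l ∧ f.app Dias.vdash = r := by
  refine ⟨presented.lift (fun i => match i with
    | .dashv => l
    | .vdash => r) ?_, rfl, rfl⟩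
  rintro I _ k x y ⟨⟩
  · exact h.d_vdash
  · exact h.d_dashv
  · exact h.rel₁
  · exact h.rel₂
  · exact h.rel₃
  · exact h.rel₄
  · exact h.rel₅

theorem Dias.hom_ext {Q : DGOperad} {f f' : Hom Dias Q}
    (h₁ : f.app Dias.dashv = f'.app Dias.dashv)
    (h₂ : f.app Dias.vdash = f'.app Dias.vdash) : f = f' :=
  presented.hom_ext fun i => match i with
  | .dashv => h₁
  | .vdash => h₂

/-- The defining relations of `Leib`, for elements of an arbitrary operad. -/
structure LeibRelations (Q : DGOperad) (u : Q.obj (Fin 2) 0) : Prop where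
  d_angle : Q.d u = 0
  leibniz : (Q.circ₂ u u : Q.obj (Fin 3) 0) = Q.circ₁ u u - Q.swap₂₃ (Q.circ₁ u u)

theorem LeibRelations.exists_hom {Q : DGOperad} {u : Q.obj (Fin 2) 0}
    (h : LeibRelations Q u) :
    ∃ f : Hom Leib Q, f.app Leib.angle = u := by
  refine ⟨presented.lift (fun i => match i with
    | .angle => u) ?_, rfl⟩
  rintro I _ k x y ⟨⟩
  · exact h.d_angle
  · have h' := h.leibniz
    simp only [sub_eq_add_neg] at h'
    exact h'

theorem Leib.hom_ext {Q : DGOperad} {f f' : Hom Leib Q}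
    (h : f.app Leib.angle = f'.app Leib.angle) : f = f' :=
  presented.hom_ext fun i => match i with
  | .angle => h

/-! ### The defining relations with arbitrary labels -/

open DGOperad

section Relabelled

variable {Q : DGOperad} (i j k : Fin 3)

theorem ZinRelations.leftComb_prec_prec {p : Q.obj (Fin 2) 0} (h : ZinRelations Q p) :
    Q.leftComb (zero_add 0) p p i j k =
      Q.rightComb (zero_add 0) p p i j k + Q.rightComb (zero_add 0) p p i k j := by
  simpa using congrArg (Q.act ![i, j, k]) h.zinbiel

theorem DendRelations.rightComb_succ_prec {p s : Q.obj (Fin 2) 0} (h : DendRelations Q p s) :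
    Q.rightComb (zero_add 0) s p i j k = Q.leftComb (zero_add 0) p s i j k := by
  simpa using congrArg (Q.act ![i, j, k]) h.dend₁

theorem DendRelations.rightComb_succ_succ {p s : Q.obj (Fin 2) 0} (h : DendRelations Q p s) :
    Q.rightComb (zero_add 0) s s i j k =
      Q.leftComb (zero_add 0) s s i j k + Q.leftComb (zero_add 0) s p i j k := by
  simpa using congrArg (Q.act ![i, j, k]) h.dend₂

theorem DendRelations.leftComb_prec_prec {p s : Q.obj (Fin 2) 0} (h : DendRelations Q p s) :
    Q.leftComb (zero_add 0) p p i j k =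
      Q.rightComb (zero_add 0) p p i j k + Q.rightComb (zero_add 0) p s i j k := by
  simpa using congrArg (Q.act ![i, j, k]) h.dend₃

theorem PermutoRelations.leftComb_tens_tens {t : Q.obj (Fin 2) 0} {w : Q.obj (Fin 2) 1}
    (h : PermutoRelations Q t w) :
    Q.leftComb (zero_add 0) t t i j k =
      Q.rightComb (zero_add 0) t t i j k + Q.rightComb (zero_add 0) t t i k j := by
  simpa using congrArg (Q.act ![i, j, k]) h.rel₁

theorem PermutoRelations.rightComb_wedge_tens {t : Q.obj (Fin 2) 0} {w : Q.obj (Fin 2) 1}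
    (h : PermutoRelations Q t w) :
    Q.rightComb (add_zero 1) w t i j k = Q.leftComb (zero_add 1) t w i j k := by
  simpa using congrArg (Q.act ![i, j, k]) h.rel₂

theorem PermutoRelations.leftComb_wedge_tens {t : Q.obj (Fin 2) 0} {w : Q.obj (Fin 2) 1}
    (h : PermutoRelations Q t w) :
    Q.leftComb (add_zero 1) w t i j k = Q.leftComb (zero_add 1) t w i k j := by
  simpa using (congrArg (Q.act ![i, k, j]) h.rel₂').symm

theorem PermutoRelations.rightComb_wedge_wedge {t : Q.obj (Fin 2) 0} {w : Q.obj (Fin 2) 1}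
    (h : PermutoRelations Q t w) :
    Q.rightComb (by decide : (1 : ℤ) + 1 = 2) w w i j k =
      -Q.leftComb (by decide : (1 : ℤ) + 1 = 2) w w i j k := by
  simpa [h.wedge_antisymm] using (congrArg (Q.act ![i, j, k]) h.rel₃).symm

theorem KRelations.rightComb_gt_lt {l g : Q.obj (Fin 2) 0} {b : Q.obj (Fin 2) 1}
    (h : KRelations Q l g b) :
    Q.rightComb (zero_add 0) g l i j k = Q.leftComb (zero_add 0) l g i j k := by
  simpa using congrArg (Q.act ![i, j, k]) h.rel₁

theorem KRelations.rightComb_gt_gt {l g : Q.obj (Fin 2) 0} {b : Q.obj (Fin 2) 1}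
    (h : KRelations Q l g b) :
    Q.rightComb (zero_add 0) g g i j k =
      Q.leftComb (zero_add 0) g g i j k + Q.leftComb (zero_add 0) g l i j k := by
  simpa using congrArg (Q.act ![i, j, k]) h.rel₂

theorem KRelations.leftComb_lt_lt {l g : Q.obj (Fin 2) 0} {b : Q.obj (Fin 2) 1}
    (h : KRelations Q l g b) :
    Q.leftComb (zero_add 0) l l i j k =
      Q.rightComb (zero_add 0) l l i j k + Q.rightComb (zero_add 0) l g i j k := by
  simpa using congrArg (Q.act ![i, j, k]) h.rel₃

theorem KRelations.rightComb_gt_bar {l g : Q.obj (Fin 2) 0} {b : Q.obj (Fin 2) 1}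
    (h : KRelations Q l g b) :
    Q.rightComb (zero_add 1) g b i j k = Q.leftComb (add_zero 1) b g i j k := by
  simpa using congrArg (Q.act ![i, j, k]) h.rel₄

theorem KRelations.leftComb_lt_bar {l g : Q.obj (Fin 2) 0} {b : Q.obj (Fin 2) 1}
    (h : KRelations Q l g b) :
    Q.leftComb (zero_add 1) l b i j k = Q.rightComb (add_zero 1) b l i j k := by
  simpa using congrArg (Q.act ![i, j, k]) h.rel₅

theorem KRelations.leftComb_bar_lt {l g : Q.obj (Fin 2) 0} {b : Q.obj (Fin 2) 1}
    (h : KRelations Q l g b) :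
    Q.leftComb (add_zero 1) b l i j k = Q.rightComb (add_zero 1) b g i j k := by
  simpa using congrArg (Q.act ![i, j, k]) h.rel₆

theorem KRelations.leftComb_bar_bar {l g : Q.obj (Fin 2) 0} {b : Q.obj (Fin 2) 1}
    (h : KRelations Q l g b) :
    Q.leftComb (by decide : (1 : ℤ) + 1 = 2) b b i j k =
      -Q.rightComb (by decide : (1 : ℤ) + 1 = 2) b b i j k := by
  simpa using congrArg (Q.act ![i, j, k]) h.rel₇

/-- The pre-Lie relation says that the associator is symmetric in its last two arguments. -/
theorem LambdaRelations.leftComb_graft_graft {a : Q.obj (Fin 2) 0} {c : Q.obj (Fin 2) 1}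
    (h : LambdaRelations Q a c) :
    Q.leftComb (zero_add 0) a a i j k = Q.rightComb (zero_add 0) a a i j k +
        (Q.leftComb (zero_add 0) a a i k j - Q.rightComb (zero_add 0) a a i k j) := by
  rw [← sub_eq_iff_eq_add']
  simpa using congrArg (Q.act ![i, j, k]) h.preLie

theorem AsRelations.leftComb_mul_mul {m : Q.obj (Fin 2) 0} (h : AsRelations Q m) :
    Q.leftComb (zero_add 0) m m i j k = Q.rightComb (zero_add 0) m m i j k := by
  simpa using congrArg (Q.act ![i, j, k]) h.assoc

theorem ComRelations.leftComb_mul_mul {m : Q.obj (Fin 2) 0} (h : ComRelations Q m) :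
    Q.leftComb (zero_add 0) m m i j k = Q.rightComb (zero_add 0) m m i j k := by
  simpa using congrArg (Q.act ![i, j, k]) h.assoc

theorem ComRelations.rightComb_mul_mul_swap₂₃ {m : Q.obj (Fin 2) 0} (h : ComRelations Q m) :
    Q.rightComb (zero_add 0) m m i j k = Q.rightComb (zero_add 0) m m i k j := by
  rw [← rightComb_swap_right, h.mul_symm]

theorem ComRelations.rightComb_mul_mul_swap₁₂ {m : Q.obj (Fin 2) 0} (h : ComRelations Q m) :
    Q.rightComb (zero_add 0) m m i j k = Q.rightComb (zero_add 0) m m j i k := by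
  rw [← h.leftComb_mul_mul, ← leftComb_swap_right, h.mul_symm, h.leftComb_mul_mul]

theorem LieRelations.rightComb_bracket_bracket {c : Q.obj (Fin 2) 0} (h : LieRelations Q c) :
    Q.rightComb (zero_add 0) c c i j k = -Q.leftComb (zero_add 0) c c j k i := by
  rw [← leftComb_swap_left, h.bracket_antisymm, leftComb_neg_left]

theorem LieRelations.leftComb_bracket_bracket_swap {c : Q.obj (Fin 2) 0} (h : LieRelations Q c) :
    Q.leftComb (zero_add 0) c c j i k = -Q.leftComb (zero_add 0) c c i j k := by
  rw [← leftComb_swap_right, h.bracket_antisymm, leftComb_neg_right]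

theorem LieRelations.leftComb_bracket_bracket_jacobi {c : Q.obj (Fin 2) 0} (h : LieRelations Q c) :
    Q.leftComb (zero_add 0) c c i j k + Q.leftComb (zero_add 0) c c k i j +
        Q.leftComb (zero_add 0) c c j k i = 0 := by
  simpa using congrArg (Q.act ![i, j, k]) h.jacobi

theorem PascRelations.leftComb_e_e {e : Q.obj (Fin 2) 0} {w : Q.obj (Fin 2) (-1)}
    (h : PascRelations Q e w) :
    Q.leftComb (zero_add 0) e e i j k = Q.rightComb (zero_add 0) e e i j k := by
  simpa using congrArg (Q.act ![i, j, k]) h.rel₁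

theorem PascRelations.rightComb_e_e_swap₂₃ {e : Q.obj (Fin 2) 0} {w : Q.obj (Fin 2) (-1)}
    (h : PascRelations Q e w) :
    Q.rightComb (zero_add 0) e e i j k = Q.rightComb (zero_add 0) e e i k j := by
  simpa using congrArg (Q.act ![j, k, i]) h.rel₂

theorem PascRelations.leftComb_wedge_e {e : Q.obj (Fin 2) 0} {w : Q.obj (Fin 2) (-1)}
    (h : PascRelations Q e w) :
    Q.leftComb (add_zero (-1)) w e i j k = Q.leftComb (zero_add (-1)) e w i k j := by
  simpa using congrArg (Q.act ![i, k, j]) h.rel₅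

theorem PascRelations.rightComb_wedge_e {e : Q.obj (Fin 2) 0} {w : Q.obj (Fin 2) (-1)}
    (h : PascRelations Q e w) :
    Q.rightComb (add_zero (-1)) w e i j k = Q.leftComb (zero_add (-1)) e w i j k := by
  rw [← leftComb_swap_left, h.wedge_antisymm, leftComb_neg_left]
  simpa using congrArg (Q.act ![i, j, k]) h.rel₆

theorem PascRelations.rightComb_e_wedge {e : Q.obj (Fin 2) 0} {w : Q.obj (Fin 2) (-1)}
    (h : PascRelations Q e w) :
    Q.rightComb (zero_add (-1)) e w i j k = 0 := by
  simpa using congrArg (Q.act ![j, k, i]) h.rel₄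

theorem PascRelations.leftComb_wedge_wedge_cycle {e : Q.obj (Fin 2) 0} {w : Q.obj (Fin 2) (-1)}
    (h : PascRelations Q e w) :
    Q.leftComb (by decide : (-1 : ℤ) + -1 = -2) w w i j k =
      Q.leftComb (by decide : (-1 : ℤ) + -1 = -2) w w k i j := by
  simpa using congrArg (Q.act ![i, j, k]) h.rel₇

theorem PascRelations.leftComb_wedge_wedge {e : Q.obj (Fin 2) 0} {w : Q.obj (Fin 2) (-1)}
    (h : PascRelations Q e w) :
    Q.leftComb (by decide : (-1 : ℤ) + -1 = -2) w w i j k =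
      -Q.rightComb (by decide : (-1 : ℤ) + -1 = -2) w w i j k := by
  rw [← leftComb_swap_left, h.wedge_antisymm, leftComb_neg_left, neg_neg,
    h.leftComb_wedge_wedge_cycle j k i]

theorem TriasRelations.leftComb_dashv_vdash {l r : Q.obj (Fin 2) 0} {x : Q.obj (Fin 2) (-1)}
    (h : TriasRelations Q l r x) :
    Q.leftComb (zero_add 0) l r i j k = Q.rightComb (zero_add 0) r l i j k := by
  simpa using congrArg (Q.act ![i, j, k]) h.rel₁

theorem TriasRelations.rightComb_dashv_dashv {l r : Q.obj (Fin 2) 0} {x : Q.obj (Fin 2) (-1)}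
    (h : TriasRelations Q l r x) :
    Q.rightComb (zero_add 0) l l i j k = Q.rightComb (zero_add 0) l r i j k := by
  simpa using congrArg (Q.act ![i, j, k]) h.rel₂

theorem TriasRelations.leftComb_dashv_dashv {l r : Q.obj (Fin 2) 0} {x : Q.obj (Fin 2) (-1)}
    (h : TriasRelations Q l r x) :
    Q.leftComb (zero_add 0) l l i j k = Q.rightComb (zero_add 0) l r i j k := by
  simpa using congrArg (Q.act ![i, j, k]) h.rel₃

theorem TriasRelations.leftComb_vdash_vdash {l r : Q.obj (Fin 2) 0} {x : Q.obj (Fin 2) (-1)}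
    (h : TriasRelations Q l r x) :
    Q.leftComb (zero_add 0) r r i j k = Q.leftComb (zero_add 0) r l i j k := by
  simpa using congrArg (Q.act ![i, j, k]) h.rel₄

theorem TriasRelations.rightComb_vdash_vdash {l r : Q.obj (Fin 2) 0} {x : Q.obj (Fin 2) (-1)}
    (h : TriasRelations Q l r x) :
    Q.rightComb (zero_add 0) r r i j k = Q.leftComb (zero_add 0) r l i j k := by
  simpa using congrArg (Q.act ![i, j, k]) h.rel₅

theorem TriasRelations.leftComb_cross_vdash {l r : Q.obj (Fin 2) 0} {x : Q.obj (Fin 2) (-1)}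
    (h : TriasRelations Q l r x) :
    Q.leftComb (add_zero (-1)) x r i j k = Q.rightComb (zero_add (-1)) r x i j k := by
  simpa using congrArg (Q.act ![i, j, k]) h.rel₆

theorem TriasRelations.rightComb_cross_dashv {l r : Q.obj (Fin 2) 0} {x : Q.obj (Fin 2) (-1)}
    (h : TriasRelations Q l r x) :
    Q.rightComb (add_zero (-1)) x l i j k = Q.leftComb (zero_add (-1)) l x i j k := by
  simpa using congrArg (Q.act ![i, j, k]) h.rel₇

theorem TriasRelations.leftComb_cross_dashv {l r : Q.obj (Fin 2) 0} {x : Q.obj (Fin 2) (-1)}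
    (h : TriasRelations Q l r x) :
    Q.leftComb (add_zero (-1)) x l i j k = Q.rightComb (add_zero (-1)) x r i j k := by
  simpa using congrArg (Q.act ![i, j, k]) h.rel₈

theorem TriasRelations.leftComb_vdash_cross {l r : Q.obj (Fin 2) 0} {x : Q.obj (Fin 2) (-1)}
    (h : TriasRelations Q l r x) :
    Q.leftComb (zero_add (-1)) r x i j k = 0 := by
  simpa using congrArg (Q.act ![i, j, k]) h.rel₉

theorem TriasRelations.rightComb_dashv_cross {l r : Q.obj (Fin 2) 0} {x : Q.obj (Fin 2) (-1)}
    (h : TriasRelations Q l r x) :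
    Q.rightComb (zero_add (-1)) l x i j k = 0 := by
  simpa using congrArg (Q.act ![i, j, k]) h.rel₁₀

theorem TriasRelations.leftComb_cross_cross {l r : Q.obj (Fin 2) 0} {x : Q.obj (Fin 2) (-1)}
    (h : TriasRelations Q l r x) :
    Q.leftComb (by decide : (-1 : ℤ) + -1 = -2) x x i j k =
      -Q.rightComb (by decide : (-1 : ℤ) + -1 = -2) x x i j k := by
  simpa using congrArg (Q.act ![i, j, k]) h.rel₁₁

theorem AmalgRelations.rightComb_angle_angle {u : Q.obj (Fin 2) 0} {c : Q.obj (Fin 2) (-1)}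
    (h : AmalgRelations Q u c) :
    Q.rightComb (zero_add 0) u u i j k =
      Q.leftComb (zero_add 0) u u i j k - Q.leftComb (zero_add 0) u u i k j := by
  have := congrArg (Q.act ![i, k, j]) h.rel₁
  simp at this
  rw [eq_sub_iff_add_eq, ← sub_eq_zero, ← this]
  abel

theorem PermRelations.leftComb_mul_mul {m : Q.obj (Fin 2) 0} (h : PermRelations Q m) :
    Q.leftComb (zero_add 0) m m i j k = Q.rightComb (zero_add 0) m m i j k := by
  simpa using congrArg (Q.act ![i, j, k]) h.assoc

theorem PermRelations.rightComb_mul_mul_swap₂₃ {m : Q.obj (Fin 2) 0} (h : PermRelations Q m) :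
    Q.rightComb (zero_add 0) m m i j k = Q.rightComb (zero_add 0) m m i k j := by
  simpa using congrArg (Q.act ![i, j, k]) h.perm

theorem DiasRelations.leftComb_dashv_vdash {l r : Q.obj (Fin 2) 0} (h : DiasRelations Q l r) :
    Q.leftComb (zero_add 0) l r i j k = Q.rightComb (zero_add 0) r l i j k := by
  simpa using congrArg (Q.act ![i, j, k]) h.rel₁

theorem DiasRelations.rightComb_dashv_dashv {l r : Q.obj (Fin 2) 0} (h : DiasRelations Q l r) :
    Q.rightComb (zero_add 0) l l i j k = Q.rightComb (zero_add 0) l r i j k := by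
  simpa using congrArg (Q.act ![i, j, k]) h.rel₂

theorem DiasRelations.leftComb_dashv_dashv {l r : Q.obj (Fin 2) 0} (h : DiasRelations Q l r) :
    Q.leftComb (zero_add 0) l l i j k = Q.rightComb (zero_add 0) l r i j k := by
  simpa using congrArg (Q.act ![i, j, k]) h.rel₃

theorem DiasRelations.leftComb_vdash_vdash {l r : Q.obj (Fin 2) 0} (h : DiasRelations Q l r) :
    Q.leftComb (zero_add 0) r r i j k = Q.leftComb (zero_add 0) r l i j k := by
  simpa using congrArg (Q.act ![i, j, k]) h.rel₄

theorem DiasRelations.rightComb_vdash_vdash {l r : Q.obj (Fin 2) 0} (h : DiasRelations Q l r) :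
    Q.rightComb (zero_add 0) r r i j k = Q.leftComb (zero_add 0) r l i j k := by
  simpa using congrArg (Q.act ![i, j, k]) h.rel₅

end Relabelled

/-! ### Relations carried along the horizontal arrows -/

section Transfer

variable {Q : DGOperad}

theorem ZinRelations.dend {p : Q.obj (Fin 2) 0} (h : ZinRelations Q p) :
    DendRelations Q p (Q.swap p) where
  d_prec := h.d_prec
  d_succ := by simp [d_swap p, h.d_prec]
  dend₁ := by simp [h.leftComb_prec_prec, add_comm]
  dend₂ := by simp [h.leftComb_prec_prec]
  dend₃ := by simp [h.leftComb_prec_prec]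

theorem DendRelations.preLie {p s : Q.obj (Fin 2) 0} (h : DendRelations Q p s) :
    PreLieRelations Q (p - Q.swap s) where
  d_graft := by simp [d_swap s, h.d_prec, h.d_succ]
  preLie := by
    simp [h.rightComb_succ_prec, h.rightComb_succ_succ, h.leftComb_prec_prec]
    abel

theorem PermutoRelations.k {t : Q.obj (Fin 2) 0} {w : Q.obj (Fin 2) 1}
    (h : PermutoRelations Q t w) : KRelations Q t (Q.swap t) w where
  d_lt := h.d_tens
  d_gt := by simp [d_swap t, h.d_tens, h.wedge_antisymm]
  d_bar := h.d_wedge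
  rel₁ := by simp [h.leftComb_tens_tens, add_comm]
  rel₂ := by simp [h.leftComb_tens_tens]
  rel₃ := by simp [h.leftComb_tens_tens]
  rel₄ := by simp [h.leftComb_wedge_tens]
  rel₅ := by simp [h.rightComb_wedge_tens]
  rel₆ := by simp [h.leftComb_wedge_tens, h.rightComb_wedge_tens]
  rel₇ := by simp [h.rightComb_wedge_wedge]

theorem KRelations.lambda {l g : Q.obj (Fin 2) 0} {b : Q.obj (Fin 2) 1}
    (h : KRelations Q l g b) : LambdaRelations Q (l - Q.swap g) (b + Q.swap b) where
  bracket_symm := by simp [add_comm]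
  d_graft := by simp [d_swap g, h.d_lt, h.d_gt]
  d_bracket := by simp [d_swap b, h.d_bar]
  preLie := by
    simp [h.rightComb_gt_lt, h.rightComb_gt_gt, h.leftComb_lt_lt]
    abel
  deriv := by
    simp [h.rightComb_gt_bar, h.leftComb_lt_bar, h.leftComb_bar_lt]
    abel
  jacobi := by
    simp [h.leftComb_bar_bar]
    abel

theorem ComRelations.as {m : Q.obj (Fin 2) 0} (h : ComRelations Q m) : AsRelations Q m where
  d_mul := h.d_mul
  assoc := h.assoc

theorem AsRelations.lie {m : Q.obj (Fin 2) 0} (h : AsRelations Q m) :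
    LieRelations Q (m - Q.swap m) where
  bracket_antisymm := by simp
  d_bracket := by simp [d_swap m, h.d_mul]
  jacobi := by
    simp [h.leftComb_mul_mul]
    abel

theorem PascRelations.trias {e : Q.obj (Fin 2) 0} {w : Q.obj (Fin 2) (-1)}
    (h : PascRelations Q e w) : TriasRelations Q e (Q.swap e) w where
  d_cross := h.d_wedge
  d_vdash := by simp [d_swap e, h.d_e]
  d_dashv := h.d_e
  rel₁ := by simp [h.leftComb_e_e, h.rightComb_e_e_swap₂₃ 1]
  rel₂ := by simp [h.rightComb_e_e_swap₂₃ 0]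
  rel₃ := by simp [h.leftComb_e_e, h.rightComb_e_e_swap₂₃ 0]
  rel₄ := by simp [h.rightComb_e_e_swap₂₃ 2]
  rel₅ := by simp [h.leftComb_e_e, h.rightComb_e_e_swap₂₃ 2]
  rel₆ := by simp [h.leftComb_wedge_e]
  rel₇ := by simp [h.rightComb_wedge_e]
  rel₈ := by simp [h.leftComb_wedge_e, h.rightComb_wedge_e]
  rel₉ := by simp [h.rightComb_e_wedge]
  rel₁₀ := by simp [h.rightComb_e_wedge]
  rel₁₁ := by simp [h.leftComb_wedge_wedge]

theorem TriasRelations.amalg {l r : Q.obj (Fin 2) 0} {x : Q.obj (Fin 2) (-1)}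
    (h : TriasRelations Q l r x) : AmalgRelations Q (l - Q.swap r) (x + Q.swap x) where
  bracket_symm := by simp [add_comm]
  d_bracket := by
    rw [map_add, d_swap, h.d_cross]
    simp
    abel
  d_angle := by simp [d_swap r, h.d_dashv, h.d_vdash]
  rel₁ := by
    simp [h.leftComb_dashv_vdash, h.rightComb_dashv_dashv, h.leftComb_dashv_dashv,
      h.leftComb_vdash_vdash, h.rightComb_vdash_vdash]
    abel
  rel₂ := by
    simp [h.leftComb_cross_vdash, h.rightComb_cross_dashv, h.leftComb_cross_dashv]
    abel
  rel₃ := by simp [h.leftComb_vdash_cross, h.rightComb_dashv_cross]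
  rel₄ := by
    simp [h.leftComb_cross_cross]
    abel

theorem PermRelations.dias {m : Q.obj (Fin 2) 0} (h : PermRelations Q m) :
    DiasRelations Q m (Q.swap m) where
  d_vdash := by simp [d_swap m, h.d_mul]
  d_dashv := h.d_mul
  rel₁ := by simp [h.leftComb_mul_mul, h.rightComb_mul_mul_swap₂₃ 1]
  rel₂ := h.perm
  rel₃ := h.assoc.trans h.perm
  rel₄ := by simp [h.rightComb_mul_mul_swap₂₃ 2]
  rel₅ := by simp [h.leftComb_mul_mul, h.rightComb_mul_mul_swap₂₃ 2]

theorem DiasRelations.leib {l r : Q.obj (Fin 2) 0} (h : DiasRelations Q l r) :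
    LeibRelations Q (l - Q.swap r) where
  d_angle := by simp [d_swap r, h.d_dashv, h.d_vdash]
  leibniz := by
    simp [h.leftComb_dashv_vdash, h.rightComb_dashv_dashv, h.leftComb_dashv_dashv,
      h.leftComb_vdash_vdash, h.rightComb_vdash_vdash]
    abel

/-! ### Relations carried along the vertical arrows -/

theorem ZinRelations.permuto {p : Q.obj (Fin 2) 0} (h : ZinRelations Q p) :
    PermutoRelations Q p 0 where
  wedge_antisymm := by simp
  d_tens := h.d_prec
  d_wedge := map_zero _
  rel₁ := h.zinbiel
  rel₂ := by simp
  rel₂' := by simp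
  rel₃ := by simp

theorem DendRelations.k {p s : Q.obj (Fin 2) 0} (h : DendRelations Q p s) :
    KRelations Q p s 0 where
  d_lt := h.d_prec
  d_gt := by rw [neg_zero]; exact h.d_succ
  d_bar := map_zero _
  rel₁ := h.dend₁
  rel₂ := h.dend₂
  rel₃ := h.dend₃
  rel₄ := by simp
  rel₅ := by simp
  rel₆ := by simp
  rel₇ := by simp

theorem PreLieRelations.lambda {a : Q.obj (Fin 2) 0} (h : PreLieRelations Q a) :
    LambdaRelations Q a 0 where
  bracket_symm := swap_zero
  d_graft := h.d_graft
  d_bracket := map_zero _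
  preLie := h.preLie
  deriv := by simp
  jacobi := by simp

theorem PermutoRelations.com {t : Q.obj (Fin 2) 0} {w : Q.obj (Fin 2) 1}
    (h : PermutoRelations Q t w) : ComRelations Q (t + Q.swap t) where
  mul_symm := by simp [add_comm]
  d_mul := by
    -- The goal lives in degree `0 + 1`, the relations of `Π` in degree `1`.
    have h' : (Q.d t + Q.swap (Q.d t) : Q.obj (Fin 2) 1) = 0 := by
      rw [h.d_tens, h.wedge_antisymm, add_neg_cancel]
    rw [map_add, d_swap]
    exact h'
  assoc := by
    simp [h.leftComb_tens_tens]
    abel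

theorem KRelations.as {l g : Q.obj (Fin 2) 0} {b : Q.obj (Fin 2) 1} (h : KRelations Q l g b) :
    AsRelations Q (l + g) where
  d_mul := by
    have h' : (Q.d l + Q.d g : Q.obj (Fin 2) 1) = 0 := by rw [h.d_lt, h.d_gt, add_neg_cancel]
    rw [map_add]
    exact h'
  assoc := by
    simp [h.rightComb_gt_lt, h.rightComb_gt_gt, h.leftComb_lt_lt]
    abel

theorem LambdaRelations.lie {a : Q.obj (Fin 2) 0} {c : Q.obj (Fin 2) 1}
    (h : LambdaRelations Q a c) : LieRelations Q (a - Q.swap a) where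
  bracket_antisymm := by simp
  d_bracket := by
    have h' : (Q.d a - Q.swap (Q.d a) : Q.obj (Fin 2) 1) = 0 := by
      rw [h.d_graft, h.bracket_symm, sub_self]
    rw [map_sub, d_swap]
    exact h'
  jacobi := by
    -- The Jacobiator is the alternating sum of the six associators; exchanging the last two
    -- arguments of the three even ones makes it cancel.
    simp [h.leftComb_graft_graft 0 1 2]
    abel

theorem ComRelations.pasc {m : Q.obj (Fin 2) 0} (h : ComRelations Q m) :
    PascRelations Q m 0 where
  wedge_antisymm := by simp
  d_wedge := by rw [h.mul_symm, sub_self]; exact map_zero _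
  d_e := h.d_mul
  rel₁ := by simp [h.leftComb_mul_mul]
  rel₂ := by rw [h.mul_symm]
  rel₃ := by
    simp only [h.mul_symm, circ₁_eq, tau_eq, h.leftComb_mul_mul]
    simp [h.rightComb_mul_mul_swap₁₂ 2, h.rightComb_mul_mul_swap₂₃ 0]
  rel₄ := by simp
  rel₅ := by simp
  rel₆ := by simp
  rel₇ := by simp

theorem AsRelations.trias {m : Q.obj (Fin 2) 0} (h : AsRelations Q m) :
    TriasRelations Q m m 0 where
  d_cross := by rw [sub_self]; exact map_zero _
  d_vdash := h.d_mul
  d_dashv := h.d_mul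
  rel₁ := h.assoc
  rel₂ := rfl
  rel₃ := h.assoc
  rel₄ := rfl
  rel₅ := h.assoc.symm
  rel₆ := by simp
  rel₇ := by simp
  rel₈ := by simp
  rel₉ := by simp
  rel₁₀ := by simp
  rel₁₁ := by simp

theorem LieRelations.amalg {c : Q.obj (Fin 2) 0} (h : LieRelations Q c) :
    AmalgRelations Q c 0 where
  bracket_symm := swap_zero
  d_bracket := by rw [h.bracket_antisymm, add_neg_cancel]; exact map_zero _
  d_angle := h.d_bracket
  rel₁ := by
    -- By antisymmetry the left side is the Jacobiator.
    rw [← h.leftComb_bracket_bracket_jacobi 0 1 2]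
    simp [h.rightComb_bracket_bracket, h.leftComb_bracket_bracket_swap 2 0]
  rel₂ := by simp
  rel₃ := by simp
  rel₄ := by simp

theorem PascRelations.perm {e : Q.obj (Fin 2) 0} {w : Q.obj (Fin 2) (-1)}
    (h : PascRelations Q e w) : PermRelations Q e where
  d_mul := h.d_e
  assoc := by simp [h.leftComb_e_e]
  perm := by simp [h.rightComb_e_e_swap₂₃ 0]

theorem TriasRelations.dias {l r : Q.obj (Fin 2) 0} {x : Q.obj (Fin 2) (-1)}
    (h : TriasRelations Q l r x) : DiasRelations Q l r where
  d_vdash := h.d_vdash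
  d_dashv := h.d_dashv
  rel₁ := h.rel₁
  rel₂ := h.rel₂
  rel₃ := h.rel₃
  rel₄ := h.rel₄
  rel₅ := h.rel₅

theorem AmalgRelations.leib {u : Q.obj (Fin 2) 0} {c : Q.obj (Fin 2) (-1)}
    (h : AmalgRelations Q u c) : LeibRelations Q u where
  d_angle := h.d_angle
  leibniz := by simp [h.rightComb_angle_angle]

end Transfer

/-! ### The diagram -/

theorem Arrows.Formulas.existsUnique : ∃! D : Arrows, D.Formulas := by
  obtain ⟨dendZin, h₁, h₂⟩ := Zin.relations.dend.exists_hom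
  obtain ⟨preLieDend, h₃⟩ := Dend.relations.preLie.exists_hom
  obtain ⟨kPermuto, h₄, h₅, h₆⟩ := Permuto.relations.k.exists_hom
  obtain ⟨lambdaK, h₇, h₈⟩ := K.relations.lambda.exists_hom
  obtain ⟨asCom, h₉⟩ := Com.relations.as.exists_hom
  obtain ⟨lieAs, h₁₀⟩ := As.relations.lie.exists_hom
  obtain ⟨triasPasc, h₁₁, h₁₂, h₁₃⟩ := Pasc.relations.trias.exists_hom
  obtain ⟨amalgTrias, h₁₄, h₁₅⟩ := Trias.relations.amalg.exists_hom
  obtain ⟨diasPerm, h₁₆, h₁₇⟩ := Perm.relations.dias.exists_hom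
  obtain ⟨leibDias, h₁₈⟩ := Dias.relations.leib.exists_hom
  obtain ⟨permutoZin, h₁₉, h₂₀⟩ := Zin.relations.permuto.exists_hom
  obtain ⟨kDend, h₂₁, h₂₂, h₂₃⟩ := Dend.relations.k.exists_hom
  obtain ⟨lambdaPreLie, h₂₄, h₂₅⟩ := PreLie.relations.lambda.exists_hom
  obtain ⟨comPermuto, h₂₆⟩ := Permuto.relations.com.exists_hom
  obtain ⟨asK, h₂₇⟩ := K.relations.as.exists_hom
  obtain ⟨lieLambda, h₂₈⟩ := Lambda.relations.lie.exists_hom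
  obtain ⟨pascCom, h₂₉, h₃₀⟩ := Com.relations.pasc.exists_hom
  obtain ⟨triasAs, h₃₁, h₃₂, h₃₃⟩ := As.relations.trias.exists_hom
  obtain ⟨amalgLie, h₃₄, h₃₅⟩ := Lie.relations.amalg.exists_hom
  obtain ⟨permPasc, h₃₆⟩ := Pasc.relations.perm.exists_hom
  obtain ⟨diasTrias, h₃₇, h₃₈⟩ := Trias.relations.dias.exists_hom
  obtain ⟨leibAmalg, h₃₉⟩ := Amalg.relations.leib.exists_hom
  refine ⟨⟨dendZin, preLieDend, kPermuto, lambdaK, asCom, lieAs, triasPasc, amalgTrias, diasPerm,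
    leibDias, permutoZin, kDend, lambdaPreLie, comPermuto, asK, lieLambda, pascCom, triasAs,
    amalgLie, permPasc, diasTrias, leibAmalg⟩,
    ⟨h₁, h₂, h₃, h₄, h₅, h₆, h₇, h₈, h₉, h₁₀, h₁₁, h₁₂, h₁₃, h₁₄, h₁₅, h₁₆, h₁₇, h₁₈, h₁₉, h₂₀, h₂₁,
      h₂₂, h₂₃, h₂₄, h₂₅, h₂₆, h₂₇, h₂₈, h₂₉, h₃₀, h₃₁, h₃₂, h₃₃, h₃₄, h₃₅, h₃₆, h₃₇, h₃₈, h₃₉⟩,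
    fun D hD => Arrows.ext ?_ ?_ ?_ ?_ ?_ ?_ ?_ ?_ ?_ ?_ ?_ ?_ ?_ ?_ ?_ ?_ ?_ ?_ ?_ ?_ ?_ ?_⟩
  · exact Dend.hom_ext (hD.dendZin_prec.trans h₁.symm) (hD.dendZin_succ.trans h₂.symm)
  · exact PreLie.hom_ext (hD.preLieDend_graft.trans h₃.symm)
  · exact K.hom_ext (hD.kPermuto_lt.trans h₄.symm) (hD.kPermuto_gt.trans h₅.symm)
      (hD.kPermuto_bar.trans h₆.symm)
  · exact Lambda.hom_ext (hD.lambdaK_graft.trans h₇.symm) (hD.lambdaK_bracket.trans h₈.symm)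
  · exact As.hom_ext (hD.asCom_mul.trans h₉.symm)
  · exact Lie.hom_ext (hD.lieAs_bracket.trans h₁₀.symm)
  · exact Trias.hom_ext (hD.triasPasc_dashv.trans h₁₁.symm) (hD.triasPasc_vdash.trans h₁₂.symm)
      (hD.triasPasc_cross.trans h₁₃.symm)
  · exact Amalg.hom_ext (hD.amalgTrias_angle.trans h₁₄.symm) (hD.amalgTrias_bracket.trans h₁₅.symm)
  · exact Dias.hom_ext (hD.diasPerm_dashv.trans h₁₆.symm) (hD.diasPerm_vdash.trans h₁₇.symm)
  · exact Leib.hom_ext (hD.leibDias_angle.trans h₁₈.symm)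
  · exact Permuto.hom_ext (hD.permutoZin_tens.trans h₁₉.symm) (hD.permutoZin_wedge.trans h₂₀.symm)
  · exact K.hom_ext (hD.kDend_lt.trans h₂₁.symm) (hD.kDend_gt.trans h₂₂.symm)
      (hD.kDend_bar.trans h₂₃.symm)
  · exact Lambda.hom_ext (hD.lambdaPreLie_graft.trans h₂₄.symm)
      (hD.lambdaPreLie_bracket.trans h₂₅.symm)
  · exact Com.hom_ext (hD.comPermuto_mul.trans h₂₆.symm)
  · exact As.hom_ext (hD.asK_mul.trans h₂₇.symm)
  · exact Lie.hom_ext (hD.lieLambda_bracket.trans h₂₈.symm)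
  · exact Pasc.hom_ext (hD.pascCom_e₁.trans h₂₉.symm) (hD.pascCom_wedge.trans h₃₀.symm)
  · exact Trias.hom_ext (hD.triasAs_dashv.trans h₃₁.symm) (hD.triasAs_vdash.trans h₃₂.symm)
      (hD.triasAs_cross.trans h₃₃.symm)
  · exact Amalg.hom_ext (hD.amalgLie_angle.trans h₃₄.symm) (hD.amalgLie_bracket.trans h₃₅.symm)
  · exact Perm.hom_ext (hD.permPasc_mul.trans h₃₆.symm)
  · exact Dias.hom_ext (hD.diasTrias_dashv.trans h₃₇.symm) (hD.diasTrias_vdash.trans h₃₈.symm)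
  · exact Leib.hom_ext (hD.leibAmalg_angle.trans h₃₉.symm)

theorem Hom.comp_app {P Q R : DGOperad} (g : Hom Q R) (f : Hom P Q) {I : Type} [Finite I] {k : ℤ}
    (x : P.obj I k) : (g.comp f).app x = g.app (f.app x) :=
  rfl

theorem Hom.app_swap {P Q : DGOperad} (f : Hom P Q) {k : ℤ} (x : P.obj (Fin 2) k) :
    f.app (P.swap x) = Q.swap (f.app x) :=
  f.app_map _ x

theorem Arrows.Formulas.commutes {D : Arrows} (h : D.Formulas) : D.Commutes where
  kZin := by
    apply K.hom_ext
    · simp only [Hom.comp_app, h.kPermuto_lt, h.permutoZin_tens, h.kDend_lt, h.dendZin_prec]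
    · simp only [Hom.comp_app, h.kPermuto_gt, Hom.app_swap, h.permutoZin_tens, h.kDend_gt,
        h.dendZin_succ]
    · simp only [Hom.comp_app, h.kPermuto_bar, h.permutoZin_wedge, h.kDend_bar, map_zero]
  lambdaDend := by
    apply Lambda.hom_ext
    · simp only [Hom.comp_app, h.lambdaK_graft, map_sub, Hom.app_swap, h.kDend_lt, h.kDend_gt,
        h.lambdaPreLie_graft, h.preLieDend_graft]
    · simp only [Hom.comp_app, h.lambdaK_bracket, map_add, Hom.app_swap, h.kDend_bar,
        h.lambdaPreLie_bracket, map_zero, DGOperad.swap_zero, add_zero]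
  asPermuto := by
    apply As.hom_ext
    simp only [Hom.comp_app, h.asCom_mul, h.comPermuto_mul, h.asK_mul, map_add, h.kPermuto_lt,
      h.kPermuto_gt]
  lieK := by
    apply Lie.hom_ext
    simp only [Hom.comp_app, h.lieAs_bracket, map_sub, Hom.app_swap, h.asK_mul,
      h.lieLambda_bracket, h.lambdaK_graft, DGOperad.swap_add, DGOperad.swap_sub,
      DGOperad.swap_swap]
    abel
  triasCom := by
    apply Trias.hom_ext
    · simp only [Hom.comp_app, h.triasPasc_dashv, h.pascCom_e₁, h.triasAs_dashv, h.asCom_mul]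
    · simp only [Hom.comp_app, h.triasPasc_vdash, Pasc.e₂, Hom.app_swap, h.pascCom_e₁,
        h.triasAs_vdash, h.asCom_mul, Com.relations.mul_symm]
    · simp only [Hom.comp_app, h.triasPasc_cross, h.pascCom_wedge, h.triasAs_cross, map_zero]
  amalgAs := by
    apply Amalg.hom_ext
    · simp only [Hom.comp_app, h.amalgTrias_angle, map_sub, Hom.app_swap, h.triasAs_dashv,
        h.triasAs_vdash, h.amalgLie_angle, h.lieAs_bracket]
    · simp only [Hom.comp_app, h.amalgTrias_bracket, map_add, Hom.app_swap, h.triasAs_cross,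
        h.amalgLie_bracket, map_zero, DGOperad.swap_zero, add_zero]
  diasPasc := by
    apply Dias.hom_ext
    · simp only [Hom.comp_app, h.diasPerm_dashv, h.permPasc_mul, h.diasTrias_dashv,
        h.triasPasc_dashv]
    · simp only [Hom.comp_app, h.diasPerm_vdash, Hom.app_swap, h.permPasc_mul, h.diasTrias_vdash,
        h.triasPasc_vdash, Pasc.e₂]
  leibTrias := by
    apply Leib.hom_ext
    simp only [Hom.comp_app, h.leibDias_angle, map_sub, Hom.app_swap, h.diasTrias_dashv,
      h.diasTrias_vdash, h.leibAmalg_angle, h.amalgTrias_angle]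

end DGOp

theorem mainTheorem10 :
    (∃! D : DGOp.Arrows, D.Formulas) ∧ ∀ D : DGOp.Arrows, D.Formulas → D.Commutes :=
  ⟨DGOp.Arrows.Formulas.existsUnique, fun _ h => h.commutes⟩
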